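/- Let $d\ge 1$, write $x=(x_1,\dots,x_d)$, and let $\mathbb C\{x\}$ be the $\mathbb C$-algebra of convergent power series in $x_1,\dots,x_d$, i.e. of germs at the origin of complex analytic functions on $\mathbb C^d$. For $f\in R:=\mathbb C[x]$ and $n\ge 1$, regard $R$ as a $\mathbb C[t]$-algebra via $t\mapsto f$, let $I$ be the kernel of the multiplication map $R\otimes_{\mathbb C[t]}R\to R$, and let $\Omega_f^{(n)}:=I/I^{n+1}$, an $R$-module via $\xi\mapsto \xi\otimes 1$. The $n$-th Jacobian ideal $\mathcal J_n(f)\subseteq R$ of $f$ is the $r$-th Fitting ideal of the $R$-module $\Omega_f^{(n)}$, where $r=\binom{d-1+n}{d-1}-1$; here the $r$-th Fitting ideal of a finitely generated module $M$ is the ideal generated by the $(N-r)\times(N-r)$-minors of a relation matrix of $M$ with respect to a system of generators $v_1,\dots,v_N$ of $M$ (it does not depend on the choices). The $n$-th Nash blowup local algebra of $f$ is $\mathcal M_n(f):=\mathbb C\{x\}/\langle f,\mathcal J_n(f)\rangle$, where $\langle f,\mathcal J_n(f)\rangle$ is the ideal of $\mathbb C\{x\}$ generated by $f$ and $\mathcal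 J_n(f)$. Theorem. Let $f,g\in\mathbb C[x]$ with $f(\mathbf 0)=g(\mathbf 0)=0$. Suppose that $f$ is contact equivalent to $g$ at $\mathbf 0$, i.e. that there are an automorphism $\varphi$ of the $\mathbb C$-algebra $\mathbb C\{x\}$ and a unit $u$ of $\mathbb C\{x\}$ with $g=u\cdot\varphi(f)$. Then for every $n\ge 1$ the $\mathbb C$-algebras $\mathcal M_n(f)$ and $\mathcal M_n(g)$ are isomorphic. (The singularities of $f$ and $g$ at $\mathbf 0$ need not be isolated.) -/

import Mathlib

namespace NashBlowup

/-! ### The ring `ℂ{x₁, …, x_d}` of convergent power series -/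

/-- A formal power series in `x₁, …, x_d` over `ℂ` is convergent if it converges absolutely at
`(r, …, r)` (hence on the closed polydisc of radius `r`) for some `r > 0`. -/
def IsConvergent {d : ℕ} (f : MvPowerSeries (Fin d) ℂ) : Prop :=
  ∃ r : ℝ, 0 < r ∧ Summable fun α : Fin d →₀ ℕ => ‖MvPowerSeries.coeff α f‖ * r ^ α.degree

theorem summable_of_le {d : ℕ} {f : MvPowerSeries (Fin d) ℂ} {r s : ℝ} (hs : 0 ≤ s) (h : s ≤ r)
    (hf : Summable fun α : Fin d →₀ ℕ => ‖MvPowerSeries.coeff α f‖ * r ^ α.degree) :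
    Summable fun α : Fin d →₀ ℕ => ‖MvPowerSeries.coeff α f‖ * s ^ α.degree :=
  Summable.of_nonneg_of_le (fun α => by positivity) (fun α => by gcongr) hf

/-- Polynomials are convergent. -/
theorem isConvergent_coe {d : ℕ} (p : MvPolynomial (Fin d) ℂ) :
    IsConvergent (p : MvPowerSeries (Fin d) ℂ) := by
  refine ⟨1, one_pos, summable_of_ne_finset_zero (s := p.support) fun α hα => ?_⟩
  rw [MvPolynomial.coeff_coe, MvPolynomial.notMem_support_iff.mp hα]
  simp

theorem IsConvergent.add {d : ℕ} {f g : MvPowerSeries (Fin d) ℂ} (hf : IsConvergent f)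
    (hg : IsConvergent g) : IsConvergent (f + g) := by
  obtain ⟨r, hr, hf⟩ := hf
  obtain ⟨s, hs, hg⟩ := hg
  have hm : 0 < min r s := lt_min hr hs
  refine ⟨min r s, hm, Summable.of_nonneg_of_le (fun α => by positivity) (fun α => ?_)
    ((summable_of_le hm.le (min_le_left r s) hf).add
      (summable_of_le hm.le (min_le_right r s) hg))⟩
  rw [map_add, ← add_mul]
  gcongr
  exact norm_add_le _ _

theorem IsConvergent.mul {d : ℕ} {f g : MvPowerSeries (Fin d) ℂ} (hf : IsConvergent f)
    (hg : IsConvergent g) : IsConvergent (f * g) := by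
  obtain ⟨r, hr, hf⟩ := hf
  obtain ⟨s, hs, hg⟩ := hg
  obtain ⟨t, ht, htr, hts⟩ : ∃ t : ℝ, 0 < t ∧ t ≤ r ∧ t ≤ s :=
    ⟨min r s, lt_min hr hs, min_le_left r s, min_le_right r s⟩
  have hf' := summable_of_le ht.le htr hf
  have hg' := summable_of_le ht.le hts hg
  set F : (Fin d →₀ ℕ) → ℝ := fun α => ‖MvPowerSeries.coeff α f‖ * t ^ α.degree with hF
  set G : (Fin d →₀ ℕ) → ℝ := fun α => ‖MvPowerSeries.coeff α g‖ * t ^ α.degree with hG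
  have hF0 : ∀ α, 0 ≤ F α := fun α => by positivity
  have hG0 : ∀ α, 0 ≤ G α := fun α => by positivity
  have hFG : Summable fun α => ∑ p ∈ Finset.HasAntidiagonal.antidiagonal α, F p.1 * G p.2 :=
    summable_sum_mul_antidiagonal_of_summable_mul (hf'.mul_of_nonneg hg' hF0 hG0)
  refine ⟨t, ht, Summable.of_nonneg_of_le (fun α => by positivity) (fun α => ?_) hFG⟩
  rw [MvPowerSeries.coeff_mul]
  refine (mul_le_mul_of_nonneg_right (norm_sum_le _ _) (pow_nonneg ht.le _)).trans (le_of_eq ?_)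
  rw [Finset.sum_mul]
  refine Finset.sum_congr rfl fun p hp => ?_
  have h2 : α.degree = p.1.degree + p.2.degree := by
    rw [← Finset.HasAntidiagonal.mem_antidiagonal.mp hp, map_add]
  rw [h2, pow_add, norm_mul, hF, hG]
  ring

/-- The `ℂ`-algebra `ℂ{x} = ℂ{x₁, …, x_d}` of convergent power series, i.e. of germs at the origin
of complex analytic functions on `ℂ^d`. -/
def convergentSeries (d : ℕ) : Subalgebra ℂ (MvPowerSeries (Fin d) ℂ) where
  carrier := {f | IsConvergent f}
  add_mem' := IsConvergent.add
  mul_mem' := IsConvergent.mul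
  algebraMap_mem' c := by
    have h := isConvergent_coe (MvPolynomial.C c : MvPolynomial (Fin d) ℂ)
    rwa [MvPolynomial.coe_C] at h

/-- The inclusion `ℂ[x] → ℂ{x}`. -/
noncomputable def polyToSeries (d : ℕ) : MvPolynomial (Fin d) ℂ →ₐ[ℂ] convergentSeries d :=
  (MvPolynomial.coeToMvPowerSeries.algHom (R := ℂ) (σ := Fin d) ℂ).codRestrict
    (convergentSeries d) fun p => by
      have h := isConvergent_coe p
      have e : MvPolynomial.coeToMvPowerSeries.algHom ℂ p = (p : MvPowerSeries (Fin d) ℂ) := by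
        simp [MvPolynomial.coeToMvPowerSeries.algHom_apply]
      rw [e]
      exact h

/-- `f` is contact equivalent to `g` (at the origin): `g = u · φ(f)` for an automorphism `φ` of the
`ℂ`-algebra `ℂ{x}` and a unit `u` of `ℂ{x}`. -/
def ContactEquivalent {d : ℕ} (f g : convergentSeries d) : Prop :=
  ∃ (φ : convergentSeries d ≃ₐ[ℂ] convergentSeries d) (u : (convergentSeries d)ˣ),
    g = (u : convergentSeries d) * φ f

/-! ### Higher Kähler differentials, Fitting ideals and higher Jacobian ideals -/

/-- The module `Ω_{R/S}^{(n)} = I / I^{n+1}` of Kähler differentials of order `n`, where `I` is the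
kernel of the multiplication `R ⊗[S] R → R`. It is an `R`-module through `ξ ↦ ξ ⊗ 1`. -/
abbrev HigherDifferentials (S R : Type*) [CommRing S] [CommRing R] [Algebra S R] (n : ℕ) : Type _ :=
  KaehlerDifferential.ideal S R ⧸
    Submodule.comap (Submodule.subtype (KaehlerDifferential.ideal S R))
      (KaehlerDifferential.ideal S R ^ (n + 1))

/-- The `i`-th Fitting ideal of a finitely generated `R`-module `M`: the ideal generated by the
`(N - i) × (N - i)`-minors of the relation matrices of `M` with respect to finite systems of
generators `v₁, …, v_N`, where the empty minors (`N ≤ i`) are `1`.  Each row of `A` is one relation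
among `v₁, …, v_N`, and `c` chooses the columns of the minor. (The minors that belong to one system
of generators and to one generating set of relations already generate this ideal.) -/
def fittingIdeal (R M : Type*) [CommRing R] [AddCommGroup M] [Module R M] (i : ℕ) : Ideal R :=
  Ideal.span {m : R | ∃ (N : ℕ) (v : Fin N → M) (A : Matrix (Fin (N - i)) (Fin N) R)
    (c : Fin (N - i) → Fin N), Submodule.span R (Set.range v) = ⊤ ∧
      (∀ j, ∑ k, A j k • v k = 0) ∧ m = (A.submatrix id c).det}

/-- The module `Ω_f^{(n)}` of Kähler differentials of order `n` of the morphism `f : 𝔸^d → 𝔸^1`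
given by a polynomial `f`, i.e. of `R = ℂ[x]` over `ℂ[t]` along the homomorphism `t ↦ f`; its `r`-th
Fitting ideal with `r = binom (d - 1 + n) (d - 1) - 1` is the `n`-th Jacobian ideal
`𝒥_n(f) ⊆ ℂ[x]` of `f`. -/
noncomputable def jacobianIdeal {d : ℕ} (n : ℕ) (f : MvPolynomial (Fin d) ℂ) :
    Ideal (MvPolynomial (Fin d) ℂ) :=
  letI : Algebra (Polynomial ℂ) (MvPolynomial (Fin d) ℂ) :=
    (Polynomial.aeval f).toRingHom.toAlgebra
  fittingIdeal (MvPolynomial (Fin d) ℂ)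
    (HigherDifferentials (Polynomial ℂ) (MvPolynomial (Fin d) ℂ) n)
    ((d - 1 + n).choose (d - 1) - 1)

/-! ### The Nash blowup local algebras -/

/-- The ideal `⟨f, 𝒥_n(f)⟩` of `ℂ{x}`. -/
noncomputable def nashIdeal {d : ℕ} (n : ℕ) (f : MvPolynomial (Fin d) ℂ) :
    Ideal (convergentSeries d) :=
  Ideal.span {polyToSeries d f} ⊔ (jacobianIdeal n f).map (polyToSeries d)

/-- The `n`-th Nash blowup local algebra `ℂ{x} / ⟨f, 𝒥_n(f)⟩` of `f`. -/
abbrev NashAlgebra {d : ℕ} (n : ℕ) (f : MvPolynomial (Fin d) ℂ) : Type :=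
  convergentSeries d ⧸ nashIdeal n f

end NashBlowup

/-! The proof rests on a description of `⟨f, 𝒥_n(f)⟩` that makes sense for an arbitrary germ.

With `R = ℂ[x]` and `δ = 1 ⊗ x - x ⊗ 1`, the ring `R ⊗ R` over `ℂ[t]` is
`R[δ] / (f(x + δ) - f(x))`, so `Ω_f^{(n)}` is the quotient of the free module
`(δ) / (δ) ^ (n + 1)` by the multiples of the increment `f(x + δ) - f(x)`. Since Fitting ideals can be
computed from any presentation (`fittingIdeal_eq_minorsIdeal`), `𝒥_n(f)` is an ideal of minors of the
matrix of the multiplication by the increment (`jacobianIdeal_eq_minorsIdeal`). Such ideals of minors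
commute with base change, and the same matrix is defined for a germ `a ∈ ℂ{x}` through its Taylor
expansion `a(x + δ)`. This gives ideals `germFittingIdeal n i a` of `ℂ{x}` for all germs `a`, and
`⟨f, 𝒥_n(f)⟩` is generated by `f` and the one that belongs to the germ of `f` (`nashIdeal_eq`).

It remains to see how this ideal changes when `a` is replaced by `φ(a)` and by `u a`.

* An automorphism `φ` of `ℂ{x}` acts on the jets `ℂ{x}[δ] / (δ) ^ (n + 1)` by `φ` on the
  coefficients and by `δ i ↦ φ(x i)(x + δ) - φ(x i)`. This action carries the increment of `a` to that
  of `φ(a)` (`jetMap_germIncrement`): both sides are continuous homomorphisms in `a` which agree on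
  polynomials. Hence it is invertible, its inverse being the action of `φ⁻¹`, and up to base change
  along `φ` it is a change of generators of the module presented by the matrix. So `φ` maps the
  Fitting ideals of `a` to those of `φ(a)` (`map_germFittingIdeal`).
* The increment of `u a` is `u(x + δ) (a(x + δ) - a) + (u(x + δ) - u) a`, a multiple of the increment
  of `a` modulo `a` (`germFittingIdeal_mul_le`). For a unit `u` the converse holds as well.
-/

namespace NashBlowup

/-! ### Determinantal ideals and Fitting ideals -/

section Fitting

variable {R : Type*} [CommRing R]

/-- The ideal generated by the `k × k`-minors of a matrix (possibly with infinitely many rows).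
Rows and columns of a minor may be repeated; such minors vanish. -/
def minorsIdeal {κ ι : Type*} (B : Matrix κ ι R) (k : ℕ) : Ideal R :=
  Ideal.span {m | ∃ (ρ : Fin k → κ) (c : Fin k → ι), m = (B.submatrix ρ c).det}

theorem det_mem_minorsIdeal {κ ι : Type*} (B : Matrix κ ι R) {k : ℕ} (ρ : Fin k → κ)
    (c : Fin k → ι) : (B.submatrix ρ c).det ∈ minorsIdeal B k :=
  Ideal.subset_span ⟨ρ, c, rfl⟩

theorem minorsIdeal_zero {κ ι : Type*} (B : Matrix κ ι R) : minorsIdeal B 0 = ⊤ := by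
  rw [Ideal.eq_top_iff_one]
  have h := det_mem_minorsIdeal B (k := 0) Fin.elim0 Fin.elim0
  rwa [Matrix.det_fin_zero] at h

theorem minorsIdeal_map {S : Type*} [CommRing S] (θ : R →+* S) {κ ι : Type*} (B : Matrix κ ι R)
    (k : ℕ) : (minorsIdeal B k).map θ = minorsIdeal (B.map θ) k := by
  rw [minorsIdeal, Ideal.map_span, minorsIdeal]
  congr 1
  ext m
  constructor
  · rintro ⟨_, ⟨ρ, c, rfl⟩, rfl⟩
    exact ⟨ρ, c, by rw [RingHom.map_det]; rfl⟩
  · rintro ⟨ρ, c, rfl⟩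
    exact ⟨_, ⟨ρ, c, rfl⟩, by rw [RingHom.map_det]; rfl⟩

/-- If all maximal proper minors of the square matrix `X` lie in the ideal `a`, then so does the
determinant of each perturbation of `X` by a matrix of rank one: it is the determinant of `X`
bordered by the two factors, which is a combination of those minors by two Laplace expansions. -/
theorem det_add_rank_one_mem (a : Ideal R) {k : ℕ} (X : Matrix (Fin (k + 1)) (Fin (k + 1)) R)
    (h : ∀ ρ c : Fin k → Fin (k + 1), (X.submatrix ρ c).det ∈ a) (b s : Fin (k + 1) → R) :
    (Matrix.of fun i j => X i j + b i * s j).det ∈ a := by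
  let Y : Matrix (Fin (k + 2)) (Fin (k + 2)) R :=
    Matrix.of (Fin.cons (Fin.cons 1 (-s)) fun i => Fin.cons (b i) (X i))
  let Z : Matrix (Fin (k + 2)) (Fin (k + 2)) R :=
    Matrix.of (Fin.cons (Fin.cons 1 0) fun i => Fin.cons (b i) fun j => X i j + b i * s j)
  have hZ : Z.det = (Matrix.of fun i j => X i j + b i * s j).det := by
    rw [Matrix.det_succ_row_zero, Fin.sum_univ_succ]
    simp only [Z, Matrix.of_apply, Fin.cons_zero, Fin.cons_succ, Pi.zero_apply, mul_zero, zero_mul,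
      Finset.sum_const_zero, add_zero, Fin.val_zero, pow_zero, one_mul]
    rfl
  have hYZ : Z.det = Y.det := by
    rw [← Matrix.det_transpose Z, ← Matrix.det_transpose Y]
    refine Matrix.det_eq_of_forall_row_eq_smul_add_const (Fin.cons 0 s) 0 rfl fun j i => ?_
    refine Fin.cases ?_ (fun i => ?_) i <;> refine Fin.cases ?_ (fun j => ?_) j <;>
      simp [Y, Z, mul_comm]
  rw [← hZ, hYZ, Matrix.det_succ_row_zero]
  refine Ideal.sum_mem _ fun j _ => Ideal.mul_mem_left _ _ ?_
  refine Fin.cases ?_ (fun j => ?_) j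
  · have e : Y.submatrix Fin.succ (Fin.succAbove 0) = X := by
      ext i j; simp [Y]
    rw [e, Matrix.det_succ_row_zero]
    exact Ideal.sum_mem _ fun j _ => Ideal.mul_mem_left _ _ (h _ _)
  · rw [Matrix.det_succ_column_zero]
    refine Ideal.sum_mem _ fun i _ => Ideal.mul_mem_left _ _ ?_
    cases k with
    | zero => simpa using h Fin.elim0 Fin.elim0
    | succ k =>
      have e : (Y.submatrix Fin.succ j.succ.succAbove).submatrix i.succAbove Fin.succ =
          X.submatrix i.succAbove j.succAbove := by
        ext i j; simp [Y]
      rw [e]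
      exact h _ _

/-- Passing to linear combinations of the rows of a matrix does not produce new minors. -/
theorem minorsIdeal_le_of_rows_mem_span {κ κ' ι : Type*} (B : Matrix κ ι R) (B' : Matrix κ' ι R)
    (h : ∀ x, B x ∈ Submodule.span R (Set.range B')) (k : ℕ) :
    minorsIdeal B k ≤ minorsIdeal B' k := by
  refine Ideal.span_le.mpr ?_
  rintro _ ⟨ρ, c, rfl⟩
  have h' : ∀ i, ∃ q : κ' →₀ R, Finsupp.linearCombination R (fun x => B' x) q = B (ρ i) := fun i =>
    (Finsupp.mem_span_range_iff_exists_finsupp (R := R)).mp (h (ρ i))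
  choose q hq using h'
  classical
  let s : Finset κ' := Finset.univ.biUnion fun i => (q i).support
  have e : B.submatrix ρ c = fun i => ∑ x ∈ s, q i x • fun j => B' x (c j) := by
    funext i j
    have hqi := hq i
    rw [Finsupp.linearCombination_apply,
      Finsupp.sum_of_support_subset (s := s) _
        (Finset.subset_biUnion_of_mem (fun i => (q i).support) (Finset.mem_univ i)) _ (by simp)] at hqi
    have h2 := congrFun hqi (c j)
    simp only [Finset.sum_apply, Pi.smul_apply] at h2 ⊢
    exact h2.symm
  have e' : (B.submatrix ρ c).det = (Matrix.detRowAlternating (R := R) (n := Fin k)).toMultilinearMap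
      (fun i => ∑ x ∈ s, q i x • fun j => B' x (c j)) := by
    rw [e]; rfl
  rw [e', MultilinearMap.map_sum_finset]
  refine Ideal.sum_mem _ fun r _ => ?_
  rw [MultilinearMap.map_smul_univ]
  exact Ideal.mul_mem_left _ _ (det_mem_minorsIdeal B' r c)

variable {M : Type*} [AddCommGroup M] [Module R M]

/-- The matrix whose rows are all the relations among the finite family `v`. -/
def relationMatrix {ι : Type*} [Fintype ι] (v : ι → M) :
    Matrix (LinearMap.ker (Fintype.linearCombination R v)) ι R :=
  Matrix.of fun r => r.1

/-- The `i`-th Fitting ideal computed from one finite family of generators. -/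
def fittingOf (R : Type*) [CommRing R] {M : Type*} [AddCommGroup M] [Module R M] {ι : Type*}
    [Fintype ι] (v : ι → M) (i : ℕ) : Ideal R :=
  minorsIdeal (relationMatrix (R := R) v) (Fintype.card ι - i)

theorem det_mem_of_relations {ι : Type*} [Fintype ι] (v : ι → M) {k : ℕ}
    (A : Matrix (Fin k) ι R) (hA : ∀ j, ∑ x, A j x • v x = 0) (c : Fin k → ι) :
    (A.submatrix id c).det ∈ minorsIdeal (relationMatrix (R := R) v) k :=
  det_mem_minorsIdeal (relationMatrix (R := R) v)
    (fun j => ⟨A j, by simpa [Fintype.linearCombination_apply] using hA j⟩) c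

theorem fittingOf_reindex_le {ι ι' : Type*} [Fintype ι] [Fintype ι'] (e : ι ≃ ι') (v : ι' → M)
    (i : ℕ) : fittingOf R (v ∘ e) i ≤ fittingOf R v i := by
  rw [fittingOf, fittingOf, Fintype.card_congr e]
  refine Ideal.span_le.mpr ?_
  rintro _ ⟨ρ, c, rfl⟩
  have h := det_mem_of_relations v (Matrix.of fun j x => (ρ j).1 (e.symm x)) (fun j => ?_) (e ∘ c)
  · have e2 : (relationMatrix (v ∘ e)).submatrix ρ c =
        (Matrix.of fun j x => (ρ j).1 (e.symm x)).submatrix id (e ∘ c) := by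
      ext a b; simp [relationMatrix]
    rw [e2]
    exact h
  · have h := (ρ j).2
    rw [LinearMap.mem_ker, Fintype.linearCombination_apply] at h
    rw [← h]
    exact (Fintype.sum_equiv e _ _ fun x => by simp).symm

theorem fittingOf_reindex {ι ι' : Type*} [Fintype ι] [Fintype ι'] (e : ι ≃ ι') (v : ι' → M)
    (i : ℕ) : fittingOf R (v ∘ e) i = fittingOf R v i := by
  refine le_antisymm (fittingOf_reindex_le e v i) ?_
  have h := fittingOf_reindex_le (R := R) e.symm (v ∘ e) i
  rwa [Function.comp_assoc, Equiv.self_comp_symm, Function.comp_id] at h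

/-- Adding one redundant generator does not change the Fitting ideals. -/
theorem fittingOf_option {ι : Type*} [Fintype ι] (v : ι → M)
    (hv : Submodule.span R (Set.range v) = ⊤) (m : M) (i : ℕ) :
    fittingOf R (fun x : Option ι => x.elim m v) i = fittingOf R v i := by
  obtain ⟨t, ht⟩ : ∃ t : ι → R, ∑ x, t x • v x = m :=
    (Submodule.mem_span_range_iff_exists_fun R).mp (hv ▸ Submodule.mem_top)
  rw [fittingOf, fittingOf, Fintype.card_option]
  rcases lt_or_ge (Fintype.card ι) i with hi | hi
  · rw [Nat.sub_eq_zero_of_le hi, Nat.sub_eq_zero_of_le hi.le, minorsIdeal_zero, minorsIdeal_zero]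
  rw [Nat.sub_add_comm hi]
  generalize Fintype.card ι - i = k
  apply le_antisymm
  · refine Ideal.span_le.mpr ?_
    rintro _ ⟨ρ, c, rfl⟩
    have hρ : ∀ j, ∑ x, ((ρ j).1 (some x) + (ρ j).1 none * t x) • v x = 0 := fun j => by
      have h := (ρ j).2
      rw [LinearMap.mem_ker, Fintype.linearCombination_apply, Fintype.sum_option] at h
      simp only [Option.elim_none, Option.elim_some] at h
      simp only [add_smul, Finset.sum_add_distrib, mul_smul, ← Finset.smul_sum, ht]
      rw [add_comm]
      exact h
    -- After substituting `m = ∑ t x • v x`, the rows become relations among the `v x`, up to a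
    -- correction of rank one.
    let X : Matrix (Fin (k + 1)) (Fin (k + 1)) R := Matrix.of fun j y =>
      (c y).elim 0 fun x => (ρ j).1 (some x) + (ρ j).1 none * t x
    have e : (relationMatrix (R := R) fun x : Option ι => x.elim m v).submatrix ρ c =
        Matrix.of fun j y => X j y + (ρ j).1 none * (c y).elim 1 fun x => -t x := by
      ext j y
      cases hy : c y <;> simp [X, relationMatrix, hy]
    rw [e]
    refine det_add_rank_one_mem _ X (fun r s => ?_) _ _
    by_cases hs : ∃ z, c (s z) = none
    · obtain ⟨z, hz⟩ := hs
      rw [Matrix.det_eq_zero_of_column_eq_zero z fun j => by simp [X, hz]]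
      exact Ideal.zero_mem _
    · have hs' : ∀ z, ∃ x, c (s z) = some x := fun z =>
        Option.ne_none_iff_exists'.mp fun h => hs ⟨z, h⟩
      choose w hw using hs'
      have h := det_mem_of_relations v
        (Matrix.of fun j x => (ρ (r j)).1 (some x) + (ρ (r j)).1 none * t x) (fun j => hρ (r j)) w
      convert h using 2
      ext a b; simp [X, hw]
  · refine Ideal.span_le.mpr ?_
    rintro _ ⟨ρ, c, rfl⟩
    -- Border the minor by the relation `m - ∑ t x • v x = 0`.
    let A : Matrix (Fin (k + 1)) (Option ι) R := Matrix.of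
      (Fin.cons (fun x => x.elim 1 fun x => -t x) fun j x => x.elim 0 fun x => (ρ j).1 x)
    have h := det_mem_of_relations (fun x : Option ι => x.elim m v) A (fun j => ?_)
      (Fin.cons none fun j => some (c j))
    · rw [Matrix.det_succ_column_zero, Fin.sum_univ_succ] at h
      simp only [A, Matrix.submatrix_apply, Matrix.of_apply, Fin.cons_zero, Fin.cons_succ, id,
        Option.elim_none, mul_zero, zero_mul, Finset.sum_const_zero, add_zero, Fin.val_zero,
        pow_zero, one_mul] at h
      exact h
    · refine Fin.cases ?_ (fun j => ?_) j
      · simp [A, Fintype.sum_option, ht]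
      · have h := (ρ j).2
        rw [LinearMap.mem_ker, Fintype.linearCombination_apply] at h
        simpa [A, Fintype.sum_option] using h

/-- Adding finitely many redundant generators does not change the Fitting ideals. -/
theorem fittingOf_sum {ι : Type*} [Fintype ι] (v : ι → M)
    (hv : Submodule.span R (Set.range v) = ⊤) (i : ℕ) (N : ℕ) (w : Fin N → M) :
    fittingOf R (Sum.elim w v) i = fittingOf R v i := by
  induction N with
  | zero =>
    rw [← fittingOf_reindex (Equiv.emptySum (Fin 0) ι).symm]
    rfl
  | succ N ih =>
    let e : Option (Fin N ⊕ ι) ≃ Fin (N + 1) ⊕ ι :=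
      { toFun := fun x => x.elim (Sum.inl 0) (Sum.map Fin.succ id)
        invFun := Sum.elim (Fin.cons none fun j => some (Sum.inl j)) fun y => some (Sum.inr y)
        left_inv := by rintro (_ | x | x) <;> rfl
        right_inv := by
          rintro (x | x)
          · refine Fin.cases rfl (fun x => rfl) x
          · rfl }
    have hspan : Submodule.span R (Set.range (Sum.elim (fun j : Fin N => w j.succ) v)) = ⊤ := by
      rw [eq_top_iff, ← hv]
      exact Submodule.span_mono (by rw [Set.Sum.elim_range]; exact Set.subset_union_right)
    rw [← fittingOf_reindex e, ← ih fun j => w j.succ, ← fittingOf_option _ hspan (w 0)]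
    congr 1
    funext x
    rcases x with _ | x | x <;> rfl

/-- The Fitting ideals of a module can be computed from any finite family of generators. -/
theorem fittingIdeal_eq_fittingOf {ι : Type*} [Fintype ι] (v : ι → M)
    (hv : Submodule.span R (Set.range v) = ⊤) (i : ℕ) :
    fittingIdeal R M i = fittingOf R v i := by
  let e := (Fintype.equivFin ι).symm
  rw [← fittingOf_reindex e]
  have hv' : Submodule.span R (Set.range (v ∘ e)) = ⊤ := by
    rwa [e.surjective.range_comp]
  apply le_antisymm
  · refine Ideal.span_le.mpr ?_
    rintro _ ⟨N, w, A, c, hw, hA, rfl⟩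
    -- Both families of generators give the same ideal as their union.
    rw [← fittingOf_sum _ hv' i N w, ← fittingOf_reindex (Equiv.sumComm _ _)]
    have e2 : Sum.elim w (v ∘ e) ∘ Equiv.sumComm _ _ = Sum.elim (v ∘ e) w := by
      funext x; rcases x with x | x <;> rfl
    rw [e2, fittingOf_sum w hw]
    have h := det_mem_of_relations w A hA c
    rwa [fittingOf, Fintype.card_fin]
  · rw [fittingOf, Fintype.card_fin]
    refine Ideal.span_mono ?_
    rintro _ ⟨ρ, c, rfl⟩
    refine ⟨_, v ∘ e, Matrix.of fun j => (ρ j).1, c, hv', fun j => ?_, rfl⟩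
    have h := (ρ j).2
    rwa [LinearMap.mem_ker, Fintype.linearCombination_apply] at h

/-- A Fitting ideal is the ideal of minors of any matrix whose rows generate the relations. -/
theorem fittingIdeal_eq_minorsIdeal {κ ι : Type*} [Fintype ι] (v : ι → M)
    (hv : Submodule.span R (Set.range v) = ⊤) (B : Matrix κ ι R)
    (hB : ∀ r : ι → R, ∑ x, r x • v x = 0 ↔ r ∈ Submodule.span R (Set.range B)) (i : ℕ) :
    fittingIdeal R M i = minorsIdeal B (Fintype.card ι - i) := by
  rw [fittingIdeal_eq_fittingOf v hv, fittingOf]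
  apply le_antisymm
  · refine minorsIdeal_le_of_rows_mem_span _ _ (fun r => (hB _).mp ?_) _
    have h := r.2
    rwa [LinearMap.mem_ker, Fintype.linearCombination_apply] at h
  · refine minorsIdeal_le_of_rows_mem_span _ _ (fun x => Submodule.subset_span ?_) _
    refine ⟨⟨B x, ?_⟩, rfl⟩
    rw [LinearMap.mem_ker, Fintype.linearCombination_apply]
    exact (hB _).mpr (Submodule.subset_span ⟨x, rfl⟩)

end Fitting

/-! ### Presentations of modules of jets -/

section Jets

open MvPolynomial

variable {d : ℕ}

/-- The exponents of the monomials of degree `1, …, n` in `d` variables; these monomials form a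
basis of `(δ) / (δ) ^ (n + 1)`. -/
abbrev JetIndex (d n : ℕ) : Type := {β : Fin d →₀ ℕ // 0 < β.degree ∧ β.degree ≤ n}

noncomputable instance (d n : ℕ) : Fintype (JetIndex d n) :=
  @Fintype.ofFinite _ ((Finsupp.finite_of_degree_le n).subset fun _ hβ => hβ.2).to_subtype

variable {B : Type*} [CommRing B]

/-- The matrix of the multiplication by `F` on `(δ) / (δ) ^ (n + 1)`: its row with index `α` consists
of the coefficients of `δ ^ α * F` in degrees `1, …, n`. -/
noncomputable def jetMatrix (n : ℕ) (F : MvPolynomial (Fin d) B) :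
    Matrix (Fin d →₀ ℕ) (JetIndex d n) B :=
  Matrix.of fun α β => coeff β.1 (monomial α 1 * F)

theorem jetMatrix_map {B' : Type*} [CommRing B'] (θ : B →+* B') (n : ℕ)
    (F : MvPolynomial (Fin d) B) : (jetMatrix n F).map θ = jetMatrix n (map θ F) := by
  ext α β
  simp only [jetMatrix, Matrix.map_apply, Matrix.of_apply, ← coeff_map, map_mul, map_monomial,
    map_one]

theorem coeff_mul_mem_span_jetMatrix (n : ℕ) (q F : MvPolynomial (Fin d) B) :
    (fun β : JetIndex d n => coeff β.1 (q * F)) ∈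
      Submodule.span B (Set.range (jetMatrix n F)) := by
  induction q using MvPolynomial.induction_on' with
  | monomial u a =>
    have e : (fun β : JetIndex d n => coeff β.1 (monomial u a * F)) = a • jetMatrix n F u := by
      funext β
      have e2 : monomial u a = C a * monomial u 1 := by simp [C_mul_monomial]
      simp [jetMatrix, e2, mul_assoc, coeff_C_mul]
    rw [e]
    exact Submodule.smul_mem _ _ (Submodule.subset_span ⟨u, rfl⟩)
  | add p q hp hq =>
    simp only [add_mul, coeff_add]
    exact Submodule.add_mem _ hp hq

/-- The part of degree `1, …, n` of a polynomial without constant term differs from the polynomial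
by terms of degree greater than `n`. -/
theorem sub_sum_jet_mem (n : ℕ) (p : MvPolynomial (Fin d) B) (hp : p ∈ idealOfVars (Fin d) B) :
    p - ∑ β : JetIndex d n, monomial β.1 (coeff β.1 p) ∈ idealOfVars (Fin d) B ^ (n + 1) := by
  rw [mem_pow_idealOfVars_iff']
  intro x hx
  rw [coeff_sub, coeff_sum, sub_eq_zero]
  rcases Nat.eq_zero_or_pos x.degree with h0 | h0
  · rw [← pow_one (idealOfVars (Fin d) B), mem_pow_idealOfVars_iff'] at hp
    rw [hp x (by omega), Finset.sum_eq_zero fun β _ => ?_]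
    rw [coeff_monomial, if_neg]
    rintro rfl
    exact β.2.1.ne' h0
  · rw [Finset.sum_eq_single (⟨x, h0, by omega⟩ : JetIndex d n)]
    · simp
    · intro β _ hβ
      rw [coeff_monomial, if_neg]
      rintro rfl
      exact hβ rfl
    · simp

theorem monomial_jetIndex_mem {n : ℕ} (β : JetIndex d n) (b : B) :
    monomial β.1 b ∈ idealOfVars (Fin d) B := by
  rw [← pow_one (idealOfVars (Fin d) B), mem_pow_idealOfVars_iff']
  intro x hx
  rw [coeff_monomial, if_neg]
  rintro rfl
  have := β.2.1
  omega

theorem coeff_sum_jet {n : ℕ} (r : JetIndex d n → B) (β : JetIndex d n) :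
    coeff β.1 (∑ β : JetIndex d n, monomial β.1 (r β)) = r β := by
  rw [coeff_sum, Finset.sum_eq_single β]
  · simp
  · intro γ _ hγ
    rw [coeff_monomial, if_neg fun h => hγ (Subtype.ext h)]
  · simp

/-- The Fitting ideals of `(δ) / ((δ) ^ (n + 1) + F B[δ])` are the ideals of minors of the matrix of
the multiplication by `F`. -/
theorem fittingIdeal_eq_minorsIdeal_of_ker {M : Type*} [AddCommGroup M] [Module B M] {n : ℕ}
    (F : MvPolynomial (Fin d) B) (hF : F ∈ idealOfVars (Fin d) B)
    (q : idealOfVars (Fin d) B →ₗ[B] M) (hq : Function.Surjective q)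
    (hker : ∀ x, q x = 0 ↔ x.1 ∈ Ideal.span {F} ⊔ idealOfVars (Fin d) B ^ (n + 1)) (i : ℕ) :
    fittingIdeal B M i = minorsIdeal (jetMatrix n F) (Fintype.card (JetIndex d n) - i) := by
  let w : JetIndex d n → idealOfVars (Fin d) B := fun β =>
    ⟨monomial β.1 1, monomial_jetIndex_mem β 1⟩
  have hw : ∀ r : JetIndex d n → B,
      ((∑ β, r β • w β : idealOfVars (Fin d) B) : MvPolynomial (Fin d) B) =
        ∑ β : JetIndex d n, monomial β.1 (r β) := fun r => by
    rw [AddSubmonoidClass.coe_finsetSum]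
    refine Finset.sum_congr rfl fun β _ => ?_
    rw [Submodule.coe_smul_of_tower, smul_monomial, smul_eq_mul, mul_one]
  have hv : ∀ r : JetIndex d n → B, ∑ β, r β • q (w β) = q (∑ β, r β • w β) := fun r => by
    simp only [map_sum, map_smul]
  refine fittingIdeal_eq_minorsIdeal (fun β => q (w β)) ?_ (jetMatrix n F) (fun r => ?_) i
  · rw [eq_top_iff]
    rintro x -
    obtain ⟨p, rfl⟩ := hq x
    rw [Submodule.mem_span_range_iff_exists_fun]
    refine ⟨fun β => coeff β.1 p.1, ?_⟩
    rw [hv, eq_comm, ← sub_eq_zero, ← map_sub, hker, Submodule.coe_sub, hw]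
    exact Ideal.mem_sup_right (sub_sum_jet_mem n p.1 p.2)
  · constructor
    · intro h
      rw [hv, hker, hw] at h
      obtain ⟨y, hy, z, hz, hyz⟩ := Submodule.mem_sup.mp h
      obtain ⟨q, rfl⟩ := Ideal.mem_span_singleton'.mp hy
      have e : r = fun β : JetIndex d n => coeff β.1 (q * F) := by
        funext β
        have hβ := β.2.2
        rw [← coeff_sum_jet r β, ← hyz, coeff_add,
          (mem_pow_idealOfVars_iff' _ _).mp hz β.1 (by omega), add_zero]
      rw [e]
      exact coeff_mul_mem_span_jetMatrix n q F
    · intro h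
      induction h using Submodule.span_induction with
      | mem r h =>
        obtain ⟨α, rfl⟩ := h
        rw [hv, hker, hw]
        have h1 := sub_sum_jet_mem n (monomial α 1 * F) (Ideal.mul_mem_left _ _ hF)
        have h2 : monomial α 1 * F ∈ Ideal.span {F} ⊔ idealOfVars (Fin d) B ^ (n + 1) :=
          Ideal.mem_sup_left (Ideal.mul_mem_left _ _ (Ideal.mem_span_singleton_self F))
        have h3 := Ideal.sub_mem _ h2 (Ideal.mem_sup_right h1)
        rwa [sub_sub_cancel] at h3
      | zero => simp
      | add r s _ _ hr hs => simp only [Pi.add_apply, add_smul, Finset.sum_add_distrib, hr, hs,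
          add_zero]
      | smul b r _ hr => simp only [Pi.smul_apply, smul_assoc, ← Finset.smul_sum, hr, smul_zero]

/-- Let `T` be a quotient of `B[δ]` which agrees with `B[δ] / (F)` modulo `(δ) ^ (n + 1)`, and let
`I` be the ideal of `T` generated by `δ`. The Fitting ideals of `I / I ^ (n + 1)` are the ideals of
minors of the matrix of the multiplication by `F`. -/
theorem fittingIdeal_eq_minorsIdeal_jetMatrix {T : Type*} [CommRing T] [Algebra B T] {n : ℕ}
    (π : MvPolynomial (Fin d) B →ₐ[B] T) (hπ : Function.Surjective π)
    (F : MvPolynomial (Fin d) B) (hF : F ∈ idealOfVars (Fin d) B)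
    (hker : RingHom.ker π ⊔ idealOfVars (Fin d) B ^ (n + 1) =
      Ideal.span {F} ⊔ idealOfVars (Fin d) B ^ (n + 1))
    (I : Ideal T) (hI : (idealOfVars (Fin d) B).map π = I) (i : ℕ) :
    fittingIdeal B (I ⧸ Submodule.comap (Submodule.subtype I) (I ^ (n + 1))) i =
      minorsIdeal (jetMatrix n F) (Fintype.card (JetIndex d n) - i) := by
  have hmem : ∀ p : idealOfVars (Fin d) B, π p.1 ∈ I := fun p =>
    hI ▸ Ideal.mem_map_of_mem π p.2
  have hpow : ∀ p, π p ∈ I ^ (n + 1) ↔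
      p ∈ Ideal.span {F} ⊔ idealOfVars (Fin d) B ^ (n + 1) := fun p => by
    rw [← hker, ← hI, ← Ideal.map_pow, ← Ideal.mem_comap, Ideal.comap_map_of_surjective _ hπ,
      sup_comm]
    rfl
  let q' : idealOfVars (Fin d) B →ₗ[B] I :=
    { toFun := fun p => ⟨π p.1, hmem p⟩
      map_add' := fun x y => Subtype.ext (map_add π x.1 y.1)
      map_smul' := fun b x => Subtype.ext (map_smul π b x.1) }
  let J : Submodule T I := Submodule.comap (Submodule.subtype I) (I ^ (n + 1))
  refine fittingIdeal_eq_minorsIdeal_of_ker F hF ((J.mkQ.restrictScalars B).comp q') ?_ ?_ i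
  · rintro x
    obtain ⟨⟨y, hy⟩, rfl⟩ := J.mkQ_surjective x
    obtain ⟨p, hp, rfl⟩ := (Ideal.mem_map_iff_of_surjective _ hπ).mp (hI.symm ▸ hy)
    exact ⟨⟨p, hp⟩, rfl⟩
  · intro x
    rw [← hpow]
    exact Submodule.Quotient.mk_eq_zero J

end Jets

/-! ### The higher Jacobian ideals of a polynomial as ideals of minors -/

section Polynomials

open MvPolynomial TensorProduct

variable {d : ℕ}

/-- The Taylor expansion `p(x) ↦ p(x + δ)`, with values in the polynomials in `δ` over `ℂ[x]`. -/
noncomputable def polyTaylor (d : ℕ) :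
    MvPolynomial (Fin d) ℂ →ₐ[ℂ] MvPolynomial (Fin d) (MvPolynomial (Fin d) ℂ) :=
  aeval fun i => C (X i) + X i

theorem mem_idealOfVars_iff {B : Type*} [CommRing B] (p : MvPolynomial (Fin d) B) :
    p ∈ idealOfVars (Fin d) B ↔ constantCoeff p = 0 := by
  rw [← pow_one (idealOfVars (Fin d) B), mem_pow_idealOfVars_iff']
  constructor
  · intro h
    exact h 0 (by simp)
  · intro h x hx
    obtain rfl : x = 0 := by
      rw [← Finsupp.degree_eq_zero_iff]
      omega
    exact h

/-- The increment `p(x + δ) - p(x)`. -/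
noncomputable def increment (p : MvPolynomial (Fin d) ℂ) :
    MvPolynomial (Fin d) (MvPolynomial (Fin d) ℂ) :=
  polyTaylor d p - C p

theorem increment_mem (p : MvPolynomial (Fin d) ℂ) :
    increment p ∈ idealOfVars (Fin d) (MvPolynomial (Fin d) ℂ) := by
  rw [mem_idealOfVars_iff, increment, map_sub, constantCoeff_C, sub_eq_zero]
  have h : (constantCoeff (R := MvPolynomial (Fin d) ℂ) (σ := Fin d)).comp
      (polyTaylor d).toRingHom = RingHom.id _ := by
    refine MvPolynomial.ringHom_ext (fun r => ?_) fun i => ?_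
    · simp [polyTaylor, MvPolynomial.algebraMap_eq, MvPolynomial.algebraMap_apply]
    · simp [polyTaylor]
  exact congrArg (fun θ : _ →+* _ => θ p) h

theorem exists_tensorProduct_lift {S R Q : Type*} [CommRing S] [CommRing R] [CommRing Q]
    [Algebra S R] (a b : R →+* Q) (h : a.comp (algebraMap S R) = b.comp (algebraMap S R)) :
    ∃ ρ : R ⊗[S] R →+* Q, ∀ x y, ρ (x ⊗ₜ y) = a x * b y := by
  let _ : Algebra S Q := (a.comp (algebraMap S R)).toAlgebra
  let a' : R →ₐ[S] Q := { a with commutes' := fun s => rfl }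
  let b' : R →ₐ[S] Q := { b with commutes' := fun s => (RingHom.congr_fun h s).symm }
  exact ⟨(Algebra.TensorProduct.productMap a' b').toRingHom, fun x y =>
    Algebra.TensorProduct.productMap_apply_tmul a' b' x y⟩

section Tensor

variable [Algebra (Polynomial ℂ) (MvPolynomial (Fin d) ℂ)]

/-- The homomorphism from `R[δ]` to `R ⊗ R` that sends `δ` to `1 ⊗ x - x ⊗ 1`. -/
noncomputable def toTensor (d : ℕ) [Algebra (Polynomial ℂ) (MvPolynomial (Fin d) ℂ)] :
    MvPolynomial (Fin d) (MvPolynomial (Fin d) ℂ) →ₐ[MvPolynomial (Fin d) ℂ]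
      MvPolynomial (Fin d) ℂ ⊗[Polynomial ℂ] MvPolynomial (Fin d) ℂ :=
  aeval fun i => 1 ⊗ₜ X i - X i ⊗ₜ 1

variable {f : MvPolynomial (Fin d) ℂ}

theorem toTensor_C (p : MvPolynomial (Fin d) ℂ) : toTensor d (C p) = p ⊗ₜ 1 := by
  rw [toTensor, aeval_C, Algebra.TensorProduct.algebraMap_apply]
  rfl

theorem toTensor_polyTaylor
    (halg : ∀ s, algebraMap (Polynomial ℂ) (MvPolynomial (Fin d) ℂ) s = Polynomial.aeval f s)
    (p : MvPolynomial (Fin d) ℂ) :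
    toTensor d (polyTaylor d p) = 1 ⊗ₜ p := by
  have h : (toTensor d).toRingHom.comp (polyTaylor d).toRingHom =
      (Algebra.TensorProduct.includeRight : MvPolynomial (Fin d) ℂ →ₐ[Polynomial ℂ]
        MvPolynomial (Fin d) ℂ ⊗[Polynomial ℂ] MvPolynomial (Fin d) ℂ).toRingHom := by
    refine MvPolynomial.ringHom_ext (fun r => ?_) fun i => ?_
    · have e : (C r : MvPolynomial (Fin d) ℂ) = algebraMap (Polynomial ℂ) _ (Polynomial.C r) := by
        rw [halg, Polynomial.aeval_C, MvPolynomial.algebraMap_eq]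
      have e2 : polyTaylor d (C r) = C (C r) := by
        rw [polyTaylor, aeval_C]
        rfl
      change toTensor d (polyTaylor d (C r)) = 1 ⊗ₜ C r
      rw [e2, toTensor_C, e, Algebra.algebraMap_eq_smul_one, TensorProduct.smul_tmul]
    · change toTensor d (polyTaylor d (X i)) = 1 ⊗ₜ X i
      rw [polyTaylor, aeval_X, map_add, toTensor_C, toTensor, aeval_X]
      abel
  exact congrArg (fun θ : _ →+* _ => θ p) h

theorem toTensor_surjective
    (halg : ∀ s, algebraMap (Polynomial ℂ) (MvPolynomial (Fin d) ℂ) s = Polynomial.aeval f s) :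
    Function.Surjective (toTensor d) := by
  intro x
  induction x using TensorProduct.induction_on with
  | zero => exact ⟨0, map_zero _⟩
  | tmul a b =>
    refine ⟨C a * polyTaylor d b, ?_⟩
    rw [map_mul, toTensor_C, toTensor_polyTaylor halg, Algebra.TensorProduct.tmul_mul_tmul,
      one_mul, mul_one]
  | add x y hx hy =>
    obtain ⟨p, rfl⟩ := hx
    obtain ⟨q, rfl⟩ := hy
    exact ⟨p + q, map_add _ _ _⟩

theorem map_idealOfVars_toTensor
    (halg : ∀ s, algebraMap (Polynomial ℂ) (MvPolynomial (Fin d) ℂ) s = Polynomial.aeval f s) :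
    (idealOfVars (Fin d) (MvPolynomial (Fin d) ℂ)).map (toTensor d) =
    KaehlerDifferential.ideal (Polynomial ℂ) (MvPolynomial (Fin d) ℂ) := by
  apply le_antisymm
  · rw [Ideal.map_span, Ideal.span_le]
    rintro _ ⟨_, ⟨i, rfl⟩, rfl⟩
    rw [toTensor, aeval_X]
    exact KaehlerDifferential.one_smul_sub_smul_one_mem_ideal _ _
  · rw [← KaehlerDifferential.span_range_eq_ideal, Ideal.span_le]
    rintro _ ⟨s, rfl⟩
    have h := Ideal.mem_map_of_mem (toTensor d) (increment_mem s)
    rwa [increment, map_sub, toTensor_C, toTensor_polyTaylor halg] at h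

/-- The kernel of `R[δ] → R ⊗ R` is generated by `f(x + δ) - f(x)`: modulo this polynomial, the two
maps `p ↦ p(x)` and `p ↦ p(x + δ)` agree on `f` and thus define a map out of `R ⊗ R`. -/
theorem ker_toTensor
    (halg : ∀ s, algebraMap (Polynomial ℂ) (MvPolynomial (Fin d) ℂ) s = Polynomial.aeval f s) :
    RingHom.ker (toTensor d) = Ideal.span {increment f} := by
  apply le_antisymm
  · obtain ⟨ρ, hρ⟩ := exists_tensorProduct_lift (S := Polynomial ℂ)
      (R := MvPolynomial (Fin d) ℂ)
      (Q := MvPolynomial (Fin d) (MvPolynomial (Fin d) ℂ) ⧸ Ideal.span {increment f})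
      ((Ideal.Quotient.mk (Ideal.span {increment f})).comp C)
      ((Ideal.Quotient.mk (Ideal.span {increment f})).comp (polyTaylor d).toRingHom) (by
        refine Polynomial.ringHom_ext (fun c => ?_) ?_
        · simp [halg, polyTaylor, MvPolynomial.algebraMap_eq, MvPolynomial.algebraMap_apply]
        · simp only [RingHom.comp_apply, halg, Polynomial.aeval_X]
          rw [eq_comm, Ideal.Quotient.mk_eq_mk_iff_sub_mem]
          exact Ideal.mem_span_singleton_self _)
    have h : ρ.comp (toTensor d).toRingHom = Ideal.Quotient.mk (Ideal.span {increment f}) := by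
      refine MvPolynomial.ringHom_ext (fun p => ?_) fun i => ?_
      · change ρ (toTensor d (C p)) = _
        rw [toTensor_C, hρ, map_one, mul_one]
        rfl
      · change ρ (toTensor d (X i)) = _
        rw [toTensor, aeval_X, map_sub, hρ, hρ, map_one, map_one, one_mul, mul_one]
        change Ideal.Quotient.mk (Ideal.span {increment f}) (polyTaylor d (X i)) -
          Ideal.Quotient.mk (Ideal.span {increment f}) (C (X i)) = _
        rw [← map_sub, polyTaylor, aeval_X, add_sub_cancel_left]
    intro p hp
    rw [← Ideal.Quotient.eq_zero_iff_mem, ← h]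
    change ρ (toTensor d p) = 0
    rw [RingHom.mem_ker.mp hp, map_zero]
  · rw [Ideal.span_le, Set.singleton_subset_iff]
    have e : f = algebraMap (Polynomial ℂ) _ Polynomial.X := by rw [halg, Polynomial.aeval_X]
    change toTensor d (increment f) = 0
    rw [increment, map_sub, toTensor_C, toTensor_polyTaylor halg, sub_eq_zero]
    rw [e]
    rw [Algebra.algebraMap_eq_smul_one, TensorProduct.smul_tmul]

end Tensor

theorem jacobianIdeal_eq_minorsIdeal (n : ℕ) (f : MvPolynomial (Fin d) ℂ) :
    jacobianIdeal n f = minorsIdeal (jetMatrix n (increment f))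
      (Fintype.card (JetIndex d n) - ((d - 1 + n).choose (d - 1) - 1)) := by
  let _ : Algebra (Polynomial ℂ) (MvPolynomial (Fin d) ℂ) :=
    (Polynomial.aeval f).toRingHom.toAlgebra
  have halg : ∀ s, algebraMap (Polynomial ℂ) (MvPolynomial (Fin d) ℂ) s = Polynomial.aeval f s :=
    fun _ => rfl
  exact fittingIdeal_eq_minorsIdeal_jetMatrix (toTensor d) (toTensor_surjective halg) _
    (increment_mem f) (by rw [ker_toTensor halg]) _ (map_idealOfVars_toTensor halg) _

end Polynomials

/-! ### Germs and the ideal of germs that vanish at the origin -/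

section Series

open MvPowerSeries

variable {d : ℕ}

/-- Shifting the exponents of a convergent power series and multiplying the coefficients by factors
of at most geometric growth preserves convergence. -/
theorem IsConvergent.of_shift {a b : MvPowerSeries (Fin d) ℂ} (ha : IsConvergent a)
    (γ : Fin d →₀ ℕ) (c K : ℝ) (hK : 0 < K)
    (h : ∀ β, ‖coeff β b‖ ≤ c * K ^ β.degree * ‖coeff (γ + β) a‖) : IsConvergent b := by
  obtain ⟨r, hr, ha⟩ := ha
  refine ⟨r / K, div_pos hr hK, ?_⟩
  have h1 : Summable fun β : Fin d →₀ ℕ => ‖coeff (γ + β) a‖ * r ^ (γ + β).degree :=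
    ha.comp_injective (i := fun β => γ + β) (add_right_injective γ)
  refine Summable.of_nonneg_of_le (fun β => by positivity) (fun β => ?_)
    (h1.mul_left (c / r ^ γ.degree))
  calc ‖coeff β b‖ * (r / K) ^ β.degree
      ≤ (c * K ^ β.degree * ‖coeff (γ + β) a‖) * (r / K) ^ β.degree := by gcongr; exact h β
    _ = c / r ^ γ.degree * (‖coeff (γ + β) a‖ * r ^ (γ + β).degree) := by
      rw [map_add, pow_add, div_pow]
      field_simp

/-- The germ of the coordinate function `x i`. -/
noncomputable def coord (i : Fin d) : convergentSeries d := polyToSeries d (MvPolynomial.X i)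

theorem coe_polyToSeries (p : MvPolynomial (Fin d) ℂ) :
    (polyToSeries d p : MvPowerSeries (Fin d) ℂ) = p := by
  change MvPolynomial.coeToMvPowerSeries.algHom ℂ p = _
  simp [MvPolynomial.coeToMvPowerSeries.algHom_apply]

theorem coe_coord (i : Fin d) : (coord i : MvPowerSeries (Fin d) ℂ) = X i := by
  rw [coord, coe_polyToSeries, MvPolynomial.coe_X]

theorem algebraMap_eq_polyToSeries (c : ℂ) :
    algebraMap ℂ (convergentSeries d) c = polyToSeries d (MvPolynomial.C c) := by
  rw [← MvPolynomial.algebraMap_eq, AlgHom.commutes]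

/-- The value of a germ at the origin. -/
noncomputable def valueAtZero (d : ℕ) : convergentSeries d →+* ℂ :=
  (constantCoeff (σ := Fin d) (R := ℂ)).comp (convergentSeries d).val.toRingHom

theorem valueAtZero_apply (a : convergentSeries d) : valueAtZero d a = coeff 0 a.1 := rfl

theorem valueAtZero_algebraMap (c : ℂ) : valueAtZero d (algebraMap ℂ _ c) = c := by
  change constantCoeff (algebraMap ℂ (MvPowerSeries (Fin d) ℂ) c) = c
  simp [MvPowerSeries.algebraMap_apply]

/-- Hadamard's lemma for germs, with the factors `b i` given by Euler's identity
`∑ i, α i = |α|`. -/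
theorem exists_eq_sum_coord_mul (a : convergentSeries d) (ha : valueAtZero d a = 0) :
    ∃ b : Fin d → convergentSeries d, a = ∑ i, coord i * b i := by
  let s : Fin d → MvPowerSeries (Fin d) ℂ := fun i β =>
    ((β i + 1 : ℕ) : ℂ) / ((β.degree + 1 : ℕ) : ℂ) * coeff (Finsupp.single i 1 + β) a.1
  have hs : ∀ i, IsConvergent (s i) := fun i => by
    refine a.2.of_shift (Finsupp.single i 1) 1 1 one_pos fun β => ?_
    change ‖((β i + 1 : ℕ) : ℂ) / ((β.degree + 1 : ℕ) : ℂ) * _‖ ≤ _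
    rw [norm_mul, norm_div, Complex.norm_natCast, Complex.norm_natCast, one_pow, one_mul]
    refine mul_le_mul_of_nonneg_right ?_ (norm_nonneg _)
    refine div_le_one_of_le₀ ?_ (by positivity)
    exact_mod_cast Nat.succ_le_succ (Finsupp.le_degree i β)
  refine ⟨fun i => ⟨s i, hs i⟩, Subtype.ext ?_⟩
  rw [AddSubmonoidClass.coe_finsetSum]
  ext α
  have hX : ∀ i, coeff α ((coord i : MvPowerSeries (Fin d) ℂ) * s i) =
      (α i : ℂ) / (α.degree : ℂ) * coeff α a.1 := fun i => by
    rw [coe_coord]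
    by_cases hα : Finsupp.single i 1 ≤ α
    · obtain ⟨β, rfl⟩ := le_iff_exists_add.mp hα
      rw [X, coeff_add_monomial_mul, one_mul]
      change ((β i + 1 : ℕ) : ℂ) / ((β.degree + 1 : ℕ) : ℂ) * _ = _
      simp [add_comm]
    · have h0 : α i = 0 := by
        by_contra h
        exact hα (Finsupp.single_le_iff.mpr (Nat.one_le_iff_ne_zero.mpr h))
      rw [X, coeff_monomial_mul, if_neg hα, h0]
      simp
  rw [map_sum]
  change _ = ∑ i, coeff α ((coord i : MvPowerSeries (Fin d) ℂ) * s i)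
  simp only [hX]
  rw [← Finset.sum_mul, ← Finset.sum_div, ← Nat.cast_sum, ← Finsupp.degree_eq_sum]
  by_cases h0 : α = 0
  · subst h0
    rw [← valueAtZero_apply, ha, mul_zero]
  · have h1 : (α.degree : ℂ) ≠ 0 := by
      exact_mod_cast fun h => h0 ((Finsupp.degree_eq_zero_iff α).mp h)
    rw [div_self h1, one_mul]

/-- The germ `x i - c` is invertible for `c ≠ 0`, by the geometric series. -/
theorem isUnit_coord_sub (i : Fin d) (c : ℂ) (hc : c ≠ 0) :
    IsUnit (coord i - algebraMap ℂ (convergentSeries d) c) := by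
  classical
  let s : MvPowerSeries (Fin d) ℂ := fun β =>
    if β = Finsupp.single i (β i) then -(c⁻¹ ^ (β i + 1)) else 0
  have hs : IsConvergent s := by
    have hc' : 0 < ‖c‖ := norm_pos_iff.mpr hc
    refine ⟨‖c‖ / 2, by positivity, ?_⟩
    refine ((Finsupp.single_injective (M := ℕ) i).summable_iff fun β hβ => ?_).mp ?_
    · have h : β ≠ Finsupp.single i (β i) := fun h => hβ ⟨β i, h.symm⟩
      change ‖(if _ then _ else _ : ℂ)‖ * _ = 0
      rw [if_neg h, norm_zero, zero_mul]
    · refine (summable_geometric_two.mul_left ‖c‖⁻¹).congr fun k => ?_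
      change _ = ‖(if _ then _ else _ : ℂ)‖ * _
      simp only [Finsupp.single_eq_same, if_true, norm_neg,
        Finsupp.degree_single, div_pow, pow_succ, one_div, inv_pow]
      have h : ‖c‖ ^ k ≠ 0 := by positivity
      rw [norm_mul, norm_inv, norm_inv, norm_pow]
      field_simp
  refine IsUnit.of_mul_eq_one (⟨s, hs⟩ : convergentSeries d) (Subtype.ext ?_)
  change ((coord i : MvPowerSeries (Fin d) ℂ) - algebraMap ℂ _ c) * s = 1
  rw [coe_coord, sub_mul]
  ext β
  rw [map_sub, X, coeff_monomial_mul, one_mul, MvPowerSeries.algebraMap_apply, coeff_C_mul,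
    coeff_one]
  change (if _ then (if _ then _ else _ : ℂ) else 0) - c * (if _ then _ else _ : ℂ) = _
  by_cases hβ : β = Finsupp.single i (β i)
  · generalize β i = k at hβ
    subst hβ
    rcases k with _ | k
    · simp [hc]
    · have e : Finsupp.single i (k + 1) - Finsupp.single i 1 = Finsupp.single i k := by
        rw [← Finsupp.single_tsub, Nat.add_sub_cancel]
      simp only [e, Finsupp.single_eq_same, if_true, Finsupp.single_le_single, pow_succ]
      simp
      field_simp
      ring
  · have h1 : β ≠ 0 := by
      rintro rfl
      exact hβ (by simp)
    rw [if_neg hβ, if_neg h1, mul_zero, sub_zero]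
    split_ifs with h2 h3
    · refine absurd ?_ hβ
      obtain ⟨γ, rfl⟩ := le_iff_exists_add.mp h2
      rw [add_tsub_cancel_left] at h3
      rw [h3, ← Finsupp.single_add]
      simp
    · rfl
    · rfl

/-- An endomorphism of the algebra of germs preserves the ideal of germs that vanish at the origin,
since it preserves units. -/
theorem valueAtZero_algHom_coord (φ : convergentSeries d →ₐ[ℂ] convergentSeries d) (i : Fin d) :
    valueAtZero d (φ (coord i)) = 0 := by
  by_contra hc
  have h := ((isUnit_coord_sub i _ hc).map φ).map (valueAtZero d)
  rw [map_sub, AlgHom.commutes, map_sub, valueAtZero_algebraMap, sub_self] at h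
  exact not_isUnit_zero h

/-- The ideal of `ℂ{x}` generated by the coordinates. -/
noncomputable def coordIdeal (d : ℕ) : Ideal (convergentSeries d) :=
  Ideal.span (Set.range coord)

theorem mem_coordIdeal (a : convergentSeries d) : a ∈ coordIdeal d ↔ valueAtZero d a = 0 := by
  constructor
  · intro h
    have h2 : coordIdeal d ≤ RingHom.ker (valueAtZero d) := by
      rw [coordIdeal, Ideal.span_le]
      rintro _ ⟨i, rfl⟩
      change valueAtZero d (coord i) = 0
      rw [valueAtZero_apply, coe_coord, coeff_zero_X]
    exact h2 h
  · intro h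
    obtain ⟨b, rfl⟩ := exists_eq_sum_coord_mul a h
    exact Ideal.sum_mem _ fun i _ => Ideal.mul_mem_right _ _ (Ideal.subset_span ⟨i, rfl⟩)

theorem exists_poly_sub_mem_pow (k : ℕ) (a : convergentSeries d) :
    ∃ p, a - polyToSeries d p ∈ coordIdeal d ^ k := by
  induction k generalizing a with
  | zero => exact ⟨0, by simp⟩
  | succ k ih =>
    obtain ⟨b, hb⟩ := exists_eq_sum_coord_mul (a - algebraMap ℂ _ (valueAtZero d a))
      (by rw [map_sub, valueAtZero_algebraMap, sub_self])
    choose p hp using fun i => ih (b i)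
    refine ⟨MvPolynomial.C (valueAtZero d a) + ∑ i, MvPolynomial.X i * p i, ?_⟩
    have e : a - polyToSeries d (MvPolynomial.C (valueAtZero d a) +
        ∑ i, MvPolynomial.X i * p i) = ∑ i, coord i * (b i - polyToSeries d (p i)) := by
      simp only [mul_sub, Finset.sum_sub_distrib]
      rw [← hb, map_add, ← algebraMap_eq_polyToSeries, map_sum, sub_add_eq_sub_sub]
      simp only [map_mul, coord]
    rw [e, pow_succ']
    exact Ideal.sum_mem _ fun i _ =>
      Ideal.mul_mem_mul (Ideal.subset_span ⟨i, rfl⟩) (hp i)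

theorem le_order_of_mem_pow (k : ℕ) (a : convergentSeries d) (ha : a ∈ coordIdeal d ^ k) :
    (k : ℕ∞) ≤ order a.1 := by
  induction k generalizing a with
  | zero => simp
  | succ k ih =>
    rw [pow_succ] at ha
    refine Submodule.mul_induction_on ha (fun x hx y hy => ?_) fun x y hx hy =>
      (le_min hx hy).trans min_order_le_add
    · have h1 : (1 : ℕ∞) ≤ order y.1 := by
        rw [one_le_order_iff_constCoeff_eq_zero]
        exact (mem_coordIdeal y).mp hy
      push_cast
      exact (add_le_add (ih x hx) h1).trans le_order_mul

theorem eq_zero_of_forall_mem_pow (a : convergentSeries d) (ha : ∀ k, a ∈ coordIdeal d ^ k) :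
    a = 0 := by
  apply Subtype.ext
  ext β
  exact coeff_of_lt_order (lt_of_lt_of_le (by exact_mod_cast Nat.lt_succ_self β.degree)
    (le_order_of_mem_pow (β.degree + 1) a (ha _)))

end Series

/-! ### Taylor expansion of germs -/

section Taylor

open MvPowerSeries

variable {d : ℕ}

/-- The multi-binomial coefficient `∏ i, (γ i).choose (α i)`, defined as a coefficient of
`∏ i, (1 + X i) ^ γ i`. -/
noncomputable def multiChoose (γ α : Fin d →₀ ℕ) : ℕ :=
  MvPolynomial.coeff α (∏ i, (1 + MvPolynomial.X i) ^ γ i : MvPolynomial (Fin d) ℕ)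

theorem multiChoose_add (γ γ' α : Fin d →₀ ℕ) : multiChoose (γ + γ') α =
    ∑ p ∈ Finset.HasAntidiagonal.antidiagonal α, multiChoose γ p.1 * multiChoose γ' p.2 := by
  simp only [multiChoose, Finsupp.add_apply, pow_add, Finset.prod_mul_distrib,
    MvPolynomial.coeff_mul]

theorem multiChoose_le (γ α : Fin d →₀ ℕ) : multiChoose γ α ≤ 2 ^ γ.degree := by
  have h : MvPolynomial.eval 1 (∏ i, (1 + MvPolynomial.X i) ^ γ i : MvPolynomial (Fin d) ℕ) =
      2 ^ γ.degree := by
    rw [map_prod, Finsupp.degree_eq_sum, ← Finset.prod_pow_eq_pow_sum]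
    refine Finset.prod_congr rfl fun i _ => ?_
    simp
  rw [← h, MvPolynomial.eval_eq, multiChoose]
  by_cases hα : α ∈ (∏ i, (1 + MvPolynomial.X i) ^ γ i : MvPolynomial (Fin d) ℕ).support
  · refine le_trans (le_of_eq ?_) (Finset.single_le_sum (fun _ _ => Nat.zero_le _) hα)
    simp
  · rw [MvPolynomial.notMem_support_iff.mp hα]
    exact Nat.zero_le _

theorem multiChoose_eq_zero (γ α : Fin d →₀ ℕ) (h : ¬ α ≤ γ) : multiChoose γ α = 0 := by
  by_contra h0
  refine h fun i => ?_
  refine (MvPolynomial.monomial_le_degreeOf i (MvPolynomial.mem_support_iff.mpr h0)).trans ?_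
  refine (MvPolynomial.degreeOf_prod_le i Finset.univ _).trans ?_
  calc ∑ j, MvPolynomial.degreeOf i ((1 + MvPolynomial.X j) ^ γ j : MvPolynomial (Fin d) ℕ)
      ≤ ∑ j, γ j * (if i = j then 1 else 0) := by
        refine Finset.sum_le_sum fun j _ => (MvPolynomial.degreeOf_pow_le i _ _).trans ?_
        refine Nat.mul_le_mul_left _ ((MvPolynomial.degreeOf_add_le i _ _).trans ?_)
        rw [MvPolynomial.degreeOf_X, MvPolynomial.degreeOf_one]
        simp
    _ = γ i := by simp

theorem multiChoose_zero_right (γ : Fin d →₀ ℕ) : multiChoose γ 0 = 1 := by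
  have h : MvPolynomial.constantCoeff
      (∏ i, (1 + MvPolynomial.X i) ^ γ i : MvPolynomial (Fin d) ℕ) = 1 := by
    simp
  exact h

theorem multiChoose_single (i : Fin d) :
    multiChoose (Finsupp.single i 1) (Finsupp.single i 1) = 1 := by
  have h : (∏ j, (1 + MvPolynomial.X j) ^ (Finsupp.single i 1 : Fin d →₀ ℕ) j :
      MvPolynomial (Fin d) ℕ) = 1 + MvPolynomial.X i := by
    rw [Finset.prod_eq_single i]
    · simp
    · intro j _ hj
      rw [Finsupp.single_eq_of_ne hj, pow_zero]
    · simp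
  rw [multiChoose, h, MvPolynomial.coeff_add, MvPolynomial.coeff_X, MvPolynomial.coeff_one,
    if_neg, zero_add]
  · simp
  · intro h
    simpa using DFunLike.congr_fun h i

/-- The Hasse derivative `∂ ^ α / α!` of a germ. -/
noncomputable def hasse (α : Fin d →₀ ℕ) (a : convergentSeries d) : convergentSeries d :=
  ⟨fun β => (multiChoose (α + β) α : ℂ) * coeff (α + β) a.1, by
    refine a.2.of_shift α (2 ^ α.degree) 2 two_pos fun β => ?_
    change ‖(multiChoose (α + β) α : ℂ) * _‖ ≤ _
    rw [norm_mul, Complex.norm_natCast]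
    gcongr
    rw [← pow_add, ← map_add]
    exact_mod_cast multiChoose_le (α + β) α⟩

theorem coeff_hasse (α β : Fin d →₀ ℕ) (a : convergentSeries d) :
    coeff β (hasse α a).1 = (multiChoose (α + β) α : ℂ) * coeff (α + β) a.1 := rfl

theorem sum_antidiagonal_eq_of_le {M : Type*} [AddCommMonoid M] {α β : Fin d →₀ ℕ}
    {p : (Fin d →₀ ℕ) × (Fin d →₀ ℕ)} (hp : p.1 + p.2 = α)
    (G : (Fin d →₀ ℕ) × (Fin d →₀ ℕ) → M) (hG : ∀ q, ¬ p ≤ q → G q = 0) :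
    ∑ q ∈ Finset.HasAntidiagonal.antidiagonal (α + β), G q =
      ∑ r ∈ Finset.HasAntidiagonal.antidiagonal β, G (p + r) := by
  refine (Finset.sum_of_injOn (fun r => p + r) ?_ ?_ ?_ fun r _ => rfl).symm
  · intro r _ s _ h
    exact add_left_cancel h
  · intro r hr
    rw [Finset.mem_coe, Finset.HasAntidiagonal.mem_antidiagonal] at hr ⊢
    rw [← hp, ← hr, Prod.fst_add, Prod.snd_add, add_add_add_comm]
  · intro q hq hq'
    refine hG q fun h => hq' ?_
    obtain ⟨r, rfl⟩ := le_iff_exists_add.mp h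
    refine ⟨r, ?_, rfl⟩
    rw [Finset.HasAntidiagonal.mem_antidiagonal, ← hp, Prod.fst_add, Prod.snd_add,
      add_add_add_comm] at hq
    rw [Finset.mem_coe, Finset.HasAntidiagonal.mem_antidiagonal]
    exact add_left_cancel hq

/-- The Leibniz rule for Hasse derivatives, which amounts to Vandermonde's identity. -/
theorem hasse_mul (α : Fin d →₀ ℕ) (a b : convergentSeries d) :
    hasse α (a * b) = ∑ p ∈ Finset.HasAntidiagonal.antidiagonal α, hasse p.1 a * hasse p.2 b := by
  apply Subtype.ext
  rw [AddSubmonoidClass.coe_finsetSum]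
  ext β
  rw [coeff_hasse, map_sum]
  have h0 : (a * b : convergentSeries d).1 = a.1 * b.1 := rfl
  rw [h0, coeff_mul, Finset.mul_sum]
  have h1 : ∀ q ∈ Finset.HasAntidiagonal.antidiagonal (α + β),
      (multiChoose (α + β) α : ℂ) * (coeff q.1 a.1 * coeff q.2 b.1) =
      ∑ p ∈ Finset.HasAntidiagonal.antidiagonal α, (multiChoose q.1 p.1 : ℂ) * coeff q.1 a.1 *
        ((multiChoose q.2 p.2 : ℂ) * coeff q.2 b.1) := fun q hq => by
    rw [← Finset.HasAntidiagonal.mem_antidiagonal.mp hq, multiChoose_add]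
    push_cast
    rw [Finset.sum_mul]
    exact Finset.sum_congr rfl fun p _ => by ring
  rw [Finset.sum_congr rfl h1, Finset.sum_comm]
  refine Finset.sum_congr rfl fun p hp => ?_
  rw [Finset.HasAntidiagonal.mem_antidiagonal] at hp
  rw [sum_antidiagonal_eq_of_le hp]
  · have h2 : (hasse p.1 a * hasse p.2 b : convergentSeries d).1 =
        (hasse p.1 a).1 * (hasse p.2 b).1 := rfl
    rw [h2, coeff_mul]
    rfl
  · intro q hq
    by_cases h1 : p.1 ≤ q.1
    · rw [multiChoose_eq_zero q.2 p.2 fun h2 => hq ⟨h1, h2⟩]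
      simp
    · rw [multiChoose_eq_zero _ _ h1]
      simp

theorem hasse_zero_left (a : convergentSeries d) : hasse 0 a = a := by
  apply Subtype.ext
  ext β
  rw [coeff_hasse, multiChoose_zero_right, zero_add, Nat.cast_one, one_mul]

theorem hasse_algebraMap {α : Fin d →₀ ℕ} (hα : α ≠ 0) (c : ℂ) :
    hasse α (algebraMap ℂ (convergentSeries d) c) = 0 := by
  classical
  apply Subtype.ext
  ext β
  rw [coeff_hasse]
  change _ * coeff (α + β) (algebraMap ℂ (MvPowerSeries (Fin d) ℂ) c) = 0
  rw [MvPowerSeries.algebraMap_apply, Algebra.algebraMap_self_apply, coeff_C, if_neg, mul_zero]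
  intro h
  exact hα (add_eq_zero.mp h).1

theorem hasse_coord {α : Fin d →₀ ℕ} (hα : α ≠ 0) (i : Fin d) :
    hasse α (coord i) = if α = Finsupp.single i 1 then 1 else 0 := by
  classical
  apply Subtype.ext
  ext β
  rw [coeff_hasse, coe_coord, coeff_X]
  by_cases h : α + β = Finsupp.single i 1
  · have h2 : α = Finsupp.single i 1 := by
      have h3 := congrArg Finsupp.degree h
      rw [map_add, Finsupp.degree_single] at h3
      have h4 : α.degree ≠ 0 := fun h => hα ((Finsupp.degree_eq_zero_iff α).mp h)
      have h5 : β = 0 := (Finsupp.degree_eq_zero_iff β).mp (by omega)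
      rwa [h5, add_zero] at h
    have h5 : β = 0 := by rwa [h2, add_eq_left] at h
    subst h2 h5
    rw [if_pos rfl, add_zero, multiChoose_single, if_pos rfl]
    simp
  · rw [if_neg h, mul_zero]
    split_ifs with h2
    · have h3 : β ≠ 0 := fun h3 => h (by rw [h2, h3, add_zero])
      change 0 = coeff β (1 : MvPowerSeries (Fin d) ℂ)
      rw [coeff_one, if_neg h3]
    · rfl

/-- The Taylor expansion `a(x) ↦ a(x + δ) = ∑ α, (∂ ^ α a / α!) δ ^ α` of germs. -/
noncomputable def taylor (d : ℕ) : convergentSeries d →+* MvPowerSeries (Fin d) (convergentSeries d)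
    where
  toFun a := fun α => hasse α a
  map_one' := by
    classical
    ext1 α
    change hasse α 1 = _
    rw [coeff_one]
    split_ifs with h
    · rw [h, hasse_zero_left]
    · rw [← map_one (algebraMap ℂ (convergentSeries d)), hasse_algebraMap h]
  map_mul' a b := by
    ext1 α
    exact (hasse_mul α a b).trans (coeff_mul (R := convergentSeries d) α (fun α => hasse α a)
      (fun α => hasse α b)).symm
  map_zero' := by
    ext1 α
    apply Subtype.ext
    ext β
    change coeff β (hasse α 0).1 = 0
    rw [coeff_hasse]
    change _ * coeff _ (0 : MvPowerSeries (Fin d) ℂ) = 0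
    rw [map_zero, mul_zero]
  map_add' a b := by
    ext1 α
    apply Subtype.ext
    ext β
    change coeff β (hasse α (a + b)).1 = coeff β ((hasse α a).1 + (hasse α b).1)
    rw [map_add, coeff_hasse, coeff_hasse, coeff_hasse, ← mul_add, ← map_add]
    rfl

theorem coeff_taylor (α : Fin d →₀ ℕ) (a : convergentSeries d) :
    coeff α (taylor d a) = hasse α a := rfl

theorem taylor_algebraMap (c : ℂ) :
    taylor d (algebraMap ℂ _ c) = C (algebraMap ℂ (convergentSeries d) c) := by
  classical
  ext1 α
  rw [coeff_taylor, coeff_C]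
  split_ifs with h
  · rw [h, hasse_zero_left]
  · rw [hasse_algebraMap h]

theorem taylor_coord (i : Fin d) : taylor d (coord i) = C (coord i) + X i := by
  classical
  ext1 α
  rw [coeff_taylor, map_add, coeff_C, coeff_X]
  by_cases h : α = 0
  · subst h
    rw [hasse_zero_left, if_pos rfl, if_neg, add_zero]
    intro h
    simpa using DFunLike.congr_fun h i
  · rw [hasse_coord h, if_neg h, zero_add]

/-- The Taylor expansion of germs extends that of polynomials. -/
theorem taylor_polyToSeries (p : MvPolynomial (Fin d) ℂ) :
    taylor d (polyToSeries d p) =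
      (MvPolynomial.map (polyToSeries d).toRingHom (polyTaylor d p) :
        MvPolynomial (Fin d) (convergentSeries d)) := by
  have h : (taylor d).comp (polyToSeries d).toRingHom =
      (MvPolynomial.coeToMvPowerSeries.ringHom (R := convergentSeries d)).comp
        ((MvPolynomial.map (polyToSeries d).toRingHom).comp (polyTaylor d).toRingHom) := by
    refine MvPolynomial.ringHom_ext (fun c => ?_) fun i => ?_
    · change taylor d (polyToSeries d (MvPolynomial.C c)) = ((MvPolynomial.map
        (polyToSeries d).toRingHom (polyTaylor d (MvPolynomial.C c)) :
          MvPolynomial (Fin d) (convergentSeries d)) : MvPowerSeries (Fin d) (convergentSeries d))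
      have e : polyTaylor d (MvPolynomial.C c) = MvPolynomial.C (MvPolynomial.C c) := by
        rw [polyTaylor, MvPolynomial.aeval_C]
        rfl
      rw [e, MvPolynomial.map_C, ← algebraMap_eq_polyToSeries, taylor_algebraMap,
        MvPolynomial.coe_C, algebraMap_eq_polyToSeries]
      rfl
    · change taylor d (coord i) = ((MvPolynomial.map
        (polyToSeries d).toRingHom (polyTaylor d (MvPolynomial.X i)) :
          MvPolynomial (Fin d) (convergentSeries d)) : MvPowerSeries (Fin d) (convergentSeries d))
      rw [polyTaylor, MvPolynomial.aeval_X, map_add, MvPolynomial.map_C, MvPolynomial.map_X,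
        taylor_coord, MvPolynomial.coe_add, MvPolynomial.coe_C, MvPolynomial.coe_X]
      rfl
  exact RingHom.congr_fun h p

end Taylor

/-! ### Automorphisms act on jets of germs -/

section JetRing

open MvPolynomial

variable {d : ℕ}

/-- The ring `B[δ] / (δ) ^ (n + 1)` of `n`-jets. -/
abbrev JetRing (B : Type*) [CommRing B] (d n : ℕ) : Type _ :=
  MvPolynomial (Fin d) B ⧸ idealOfVars (Fin d) B ^ (n + 1)

/-- The projection from `B[δ]` to the ring of jets. -/
noncomputable abbrev toJetRing (B : Type*) [CommRing B] (d n : ℕ) : MvPolynomial (Fin d) B →+* JetRing B d n :=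
  Ideal.Quotient.mk _

theorem toJetRing_eq_zero_iff {B : Type*} [CommRing B] {n : ℕ} (p : MvPolynomial (Fin d) B) :
    toJetRing B d n p = 0 ↔ p ∈ idealOfVars (Fin d) B ^ (n + 1) :=
  Ideal.Quotient.eq_zero_iff_mem

/-- The Taylor polynomial of degree `n` of a germ. -/
noncomputable def jetPoly (n : ℕ) (a : convergentSeries d) :
    MvPolynomial (Fin d) (convergentSeries d) :=
  MvPowerSeries.truncTotal (n + 1) (taylor d a)

/-- The `n`-jet of a germ. -/
noncomputable def jet (d n : ℕ) : convergentSeries d →+* JetRing (convergentSeries d) d n :=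
  (MvPowerSeries.truncTotalAlgHom (Fin d) (convergentSeries d) (n + 1)).toRingHom.comp (taylor d)

theorem toJetRing_jetPoly (n : ℕ) (a : convergentSeries d) :
    toJetRing _ d n (jetPoly n a) = jet d n a := rfl

theorem jet_eq_of_taylor_eq (n : ℕ) {a : convergentSeries d}
    {p : MvPolynomial (Fin d) (convergentSeries d)} (h : taylor d a = p) :
    jet d n a = toJetRing _ d n p := by
  rw [← toJetRing_jetPoly, jetPoly, h, Ideal.Quotient.mk_eq_mk_iff_sub_mem,
    mem_pow_idealOfVars_iff']
  intro x hx
  rw [coeff_sub, sub_eq_zero, MvPowerSeries.coeff_truncTotal _ hx, MvPolynomial.coeff_coe]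

theorem jet_algebraMap (n : ℕ) (c : ℂ) :
    jet d n (algebraMap ℂ _ c) = toJetRing _ d n (C (algebraMap ℂ _ c)) :=
  jet_eq_of_taylor_eq n (by rw [taylor_algebraMap, coe_C])

theorem jet_coord (n : ℕ) (i : Fin d) :
    jet d n (coord i) = toJetRing _ d n (C (coord i) + X i) :=
  jet_eq_of_taylor_eq n (by rw [taylor_coord, coe_add, coe_C, coe_X])

/-- The increment `a(x + δ) - a(x)` of a germ, up to terms of degree greater than `n`. -/
noncomputable def germIncrement (n : ℕ) (a : convergentSeries d) :
    MvPolynomial (Fin d) (convergentSeries d) :=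
  jetPoly n a - C a

theorem germIncrement_mem (n : ℕ) (a : convergentSeries d) :
    germIncrement n a ∈ idealOfVars (Fin d) (convergentSeries d) := by
  rw [mem_idealOfVars_iff, germIncrement, map_sub, constantCoeff_C, sub_eq_zero]
  change coeff 0 (jetPoly n a) = a
  rw [jetPoly, MvPowerSeries.coeff_truncTotal _ (by simp), coeff_taylor, hasse_zero_left]

theorem toJetRing_germIncrement (n : ℕ) (a : convergentSeries d) :
    toJetRing _ d n (germIncrement n a) = jet d n a - toJetRing _ d n (C a) := by
  rw [germIncrement, map_sub, toJetRing_jetPoly]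

/-- A homomorphism from germs to jets is determined by its values on polynomials if it is continuous
for the adic topologies: polynomials are dense in `ℂ{x}`, and the ring of jets is separated. -/
theorem ringHom_ext_of_polyToSeries (n : ℕ)
    (h₁ h₂ : convergentSeries d →+* JetRing (convergentSeries d) d n)
    (h : ∀ p, h₁ (polyToSeries d p) = h₂ (polyToSeries d p))
    (hm : ∀ i, h₁ (coord i) ∈ (idealOfVars (Fin d) (convergentSeries d) ⊔
      (coordIdeal d).map C).map (toJetRing _ d n)) : h₁ = h₂ := by
  set N := (idealOfVars (Fin d) (convergentSeries d) ⊔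
      (coordIdeal d).map C).map (toJetRing _ d n) with hN
  have hmap : ∀ θ : convergentSeries d →+* JetRing (convergentSeries d) d n,
      (∀ i, θ (coord i) ∈ N) → (coordIdeal d).map θ ≤ N := fun θ hθ => by
    rw [coordIdeal, Ideal.map_span, Ideal.span_le]
    rintro _ ⟨_, ⟨i, rfl⟩, rfl⟩
    exact hθ i
  have hN₁ := hmap h₁ hm
  have hN₂ := hmap h₂ fun i => by
    have := hm i
    rwa [coord, h, ← coord] at this
  ext1 a
  have hpow : ∀ k, h₁ a - h₂ a ∈ N ^ k := fun k => by
    obtain ⟨p, hp⟩ := exists_poly_sub_mem_pow k a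
    have e : h₁ a - h₂ a = h₁ (a - polyToSeries d p) - h₂ (a - polyToSeries d p) := by
      rw [map_sub, map_sub, h]
      ring
    rw [e]
    refine Ideal.sub_mem _ (Ideal.pow_right_mono hN₁ k ?_) (Ideal.pow_right_mono hN₂ k ?_) <;>
    · rw [← Ideal.map_pow]
      exact Ideal.mem_map_of_mem _ hp
  obtain ⟨q, hq⟩ := Ideal.Quotient.mk_surjective (h₁ a - h₂ a)
  rw [← sub_eq_zero, ← hq, Ideal.Quotient.eq_zero_iff_mem, mem_pow_idealOfVars_iff']
  intro x hx
  refine eq_zero_of_forall_mem_pow _ fun k => ?_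
  have h1 := hpow (n + 1 + k)
  rw [← hq, hN, ← Ideal.map_pow, Ideal.mem_quotient_iff_mem_sup] at h1
  have h2 : q ∈ idealOfVars (Fin d) (convergentSeries d) ^ (n + 1) ⊔
      ((coordIdeal d) ^ k).map C := by
    rw [Ideal.map_pow]
    exact (sup_le Ideal.sup_pow_add_le_pow_sup_pow le_sup_left) h1
  obtain ⟨y, hy, z, hz, rfl⟩ := Submodule.mem_sup.mp h2
  rw [coeff_add, (mem_pow_idealOfVars_iff' _ _).mp hy x hx, zero_add]
  exact mem_map_C_iff.mp hz x

section JetMap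

variable (n : ℕ) (φ : convergentSeries d →ₐ[ℂ] convergentSeries d)

/-- The homomorphism to the ring of jets which is `φ` on the coefficients and sends `δ i` to the
increment of `φ (x i)`. -/
noncomputable def polyToJet :
    MvPolynomial (Fin d) (convergentSeries d) →+* JetRing (convergentSeries d) d n :=
  eval₂Hom ((toJetRing _ d n).comp (C.comp φ.toRingHom))
    fun i => toJetRing _ d n (germIncrement n (φ (coord i)))

theorem map_polyToJet_le : (idealOfVars (Fin d) (convergentSeries d)).map (polyToJet n φ) ≤
    (idealOfVars (Fin d) (convergentSeries d)).map (toJetRing _ d n) := by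
  rw [Ideal.map_span, Ideal.span_le]
  rintro _ ⟨_, ⟨i, rfl⟩, rfl⟩
  rw [polyToJet, eval₂Hom_X']
  exact Ideal.mem_map_of_mem _ (germIncrement_mem n _)

theorem polyToJet_eq_zero (p : MvPolynomial (Fin d) (convergentSeries d))
    (hp : p ∈ idealOfVars (Fin d) (convergentSeries d) ^ (n + 1)) : polyToJet n φ p = 0 := by
  have h2 := Ideal.pow_right_mono (map_polyToJet_le n φ) (n + 1)
  rw [← Ideal.map_pow, ← Ideal.map_pow, Ideal.map_quotient_self, le_bot_iff] at h2
  have h3 := Ideal.mem_map_of_mem (polyToJet n φ) hp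
  rwa [h2] at h3

/-- The action of an endomorphism of the algebra of germs on the ring of jets. -/
noncomputable def jetMap : JetRing (convergentSeries d) d n →+* JetRing (convergentSeries d) d n :=
  Ideal.Quotient.lift _ (polyToJet n φ) (polyToJet_eq_zero n φ)

theorem jetMap_toJetRing (p : MvPolynomial (Fin d) (convergentSeries d)) :
    jetMap n φ (toJetRing _ d n p) = polyToJet n φ p :=
  Ideal.Quotient.lift_mk _ _ _

theorem jetMap_C (a : convergentSeries d) :
    jetMap n φ (toJetRing _ d n (C a)) = toJetRing _ d n (C (φ a)) := by
  rw [jetMap_toJetRing, polyToJet, eval₂Hom_C]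
  rfl

theorem jetMap_X (i : Fin d) :
    jetMap n φ (toJetRing _ d n (X i)) = toJetRing _ d n (germIncrement n (φ (coord i))) := by
  rw [jetMap_toJetRing, polyToJet, eval₂Hom_X']

theorem jetMap_jet_coord (i : Fin d) : jetMap n φ (jet d n (coord i)) = jet d n (φ (coord i)) := by
  rw [jet_coord, map_add, map_add, jetMap_C, jetMap_X, toJetRing_germIncrement]
  ring

/-- Taylor expansion is natural with respect to endomorphisms of the algebra of germs. -/
theorem jetMap_jet (a : convergentSeries d) : jetMap n φ (jet d n a) = jet d n (φ a) := by
  have hV : ∀ b ∈ coordIdeal d, jet d n b ∈ (idealOfVars (Fin d) (convergentSeries d) ⊔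
      (coordIdeal d).map C).map (toJetRing _ d n) := fun b hb => by
    have h1 : coordIdeal d ≤ ((idealOfVars (Fin d) (convergentSeries d) ⊔
        (coordIdeal d).map C).map (toJetRing _ d n)).comap (jet d n) := by
      rw [coordIdeal, Ideal.span_le]
      rintro _ ⟨i, rfl⟩
      rw [SetLike.mem_coe, Ideal.mem_comap, jet_coord]
      refine Ideal.mem_map_of_mem _ (Ideal.add_mem _ (Ideal.mem_sup_right ?_)
        (Ideal.mem_sup_left (Ideal.subset_span ⟨i, rfl⟩)))
      exact Ideal.mem_map_of_mem _ (Ideal.subset_span ⟨i, rfl⟩)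
    exact h1 hb
  have h := ringHom_ext_of_polyToSeries n ((jetMap n φ).comp (jet d n))
    ((jet d n).comp φ.toRingHom) (fun p => ?_) (fun i => ?_)
  · exact RingHom.congr_fun h a
  · have h2 : ((jetMap n φ).comp (jet d n)).comp (polyToSeries d).toRingHom =
        ((jet d n).comp φ.toRingHom).comp (polyToSeries d).toRingHom := by
      refine MvPolynomial.ringHom_ext (fun c => ?_) fun i => jetMap_jet_coord n φ i
      change jetMap n φ (jet d n (polyToSeries d (C c))) = jet d n (φ (polyToSeries d (C c)))
      rw [← algebraMap_eq_polyToSeries, AlgHom.commutes, jet_algebraMap, jetMap_C, AlgHom.commutes]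
    exact RingHom.congr_fun h2 p
  · rw [RingHom.comp_apply, jetMap_jet_coord]
    exact hV _ ((mem_coordIdeal _).mpr (valueAtZero_algHom_coord φ i))

theorem jetMap_germIncrement (a : convergentSeries d) :
    jetMap n φ (toJetRing _ d n (germIncrement n a)) =
      toJetRing _ d n (germIncrement n (φ a)) := by
  rw [toJetRing_germIncrement, map_sub, jetMap_jet, jetMap_C, ← toJetRing_germIncrement]

theorem jetMap_comp (ψ : convergentSeries d →ₐ[ℂ] convergentSeries d)
    (h : ∀ a, ψ (φ a) = a) (x : JetRing (convergentSeries d) d n) :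
    jetMap n ψ (jetMap n φ x) = x := by
  have h2 : (jetMap n ψ).comp (jetMap n φ) = RingHom.id _ := by
    refine Ideal.Quotient.ringHom_ext (MvPolynomial.ringHom_ext (fun a => ?_) fun i => ?_)
    · change jetMap n ψ (jetMap n φ (toJetRing _ d n (C a))) = toJetRing _ d n (C a)
      rw [jetMap_C, jetMap_C, h]
    · change jetMap n ψ (jetMap n φ (toJetRing _ d n (X i))) = toJetRing _ d n (X i)
      rw [jetMap_X, jetMap_germIncrement, h, toJetRing_germIncrement, jet_coord, map_add]
      ring
  exact RingHom.congr_fun h2 x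

theorem jetMap_mem {x : JetRing (convergentSeries d) d n}
    (hx : x ∈ (idealOfVars (Fin d) (convergentSeries d)).map (toJetRing _ d n)) :
    jetMap n φ x ∈ (idealOfVars (Fin d) (convergentSeries d)).map (toJetRing _ d n) := by
  obtain ⟨p, hp, rfl⟩ := (Ideal.mem_map_iff_of_surjective _ Ideal.Quotient.mk_surjective).mp hx
  rw [jetMap_toJetRing]
  exact map_polyToJet_le n φ (Ideal.mem_map_of_mem _ hp)

end JetMap

end JetRing

/-! ### Contact equivalence -/

section Contact

open MvPolynomial

variable {d : ℕ}

/-- The case of `fittingIdeal_eq_minorsIdeal_jetMatrix` in which `T` is a quotient of a ring `P`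
identified with the ring of jets by a choice `ψ` of coordinates `δ`. -/
theorem fittingIdeal_quotient_eq_minorsIdeal {B P : Type*} [CommRing B] [CommRing P] [Algebra B P]
    {n : ℕ} (ψ : MvPolynomial (Fin d) B →ₐ[B] P) (hψ : Function.Surjective ψ)
    (hker : RingHom.ker ψ = idealOfVars (Fin d) B ^ (n + 1)) (F : MvPolynomial (Fin d) B)
    (hF : F ∈ idealOfVars (Fin d) B) (y : P) (hy : ψ F = y) (V : Ideal P)
    (hV : (idealOfVars (Fin d) B).map ψ = V) (I : Ideal (P ⧸ Ideal.span {y}))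
    (hI : V.map (Ideal.Quotient.mk (Ideal.span {y})) = I) (i : ℕ) :
    fittingIdeal B (I ⧸ Submodule.comap (Submodule.subtype I) (I ^ (n + 1))) i =
      minorsIdeal (jetMatrix n F) (Fintype.card (JetIndex d n) - i) := by
  refine fittingIdeal_eq_minorsIdeal_jetMatrix ((Ideal.Quotient.mkₐ B (Ideal.span {y})).comp ψ)
    (Ideal.Quotient.mk_surjective.comp hψ) F hF ?_ I ?_ i
  · have h : RingHom.ker ((Ideal.Quotient.mkₐ B (Ideal.span {y})).comp ψ) =
        Ideal.span {F} ⊔ idealOfVars (Fin d) B ^ (n + 1) := by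
      have h1 : Ideal.span {y} = (Ideal.span {F}).map ψ := by
        rw [Ideal.map_span, Set.image_singleton, hy]
      rw [← hker]
      ext p
      have h2 := Ideal.comap_map_of_surjective ψ hψ (Ideal.span {F})
      rw [← h1] at h2
      have h3 : p ∈ RingHom.ker ((Ideal.Quotient.mkₐ B (Ideal.span {y})).comp ψ) ↔
          p ∈ Ideal.comap ψ (Ideal.span {y}) := by
        rw [Ideal.mem_comap, ← Ideal.Quotient.eq_zero_iff_mem (I := Ideal.span {y})]
        rfl
      rw [h3, h2]
      rfl
    rw [h, sup_assoc, sup_idem]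
  · rw [← hI, ← hV]
    exact (Ideal.map_map ψ.toRingHom (Ideal.Quotient.mk (Ideal.span {y}))).symm

/-- A change of the coordinates `δ` does not change the ideals of minors of the multiplication
by `F`: in both coordinates they are Fitting ideals of the same module. -/
theorem minorsIdeal_jetMatrix_eq_of_algHom {B : Type*} [CommRing B] {n : ℕ}
    (ψ : MvPolynomial (Fin d) B →ₐ[B] JetRing B d n) (hψ : Function.Surjective ψ)
    (hker : RingHom.ker ψ = idealOfVars (Fin d) B ^ (n + 1))
    (hV : (idealOfVars (Fin d) B).map ψ = (idealOfVars (Fin d) B).map (toJetRing B d n))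
    {F F' : MvPolynomial (Fin d) B} (hF : F ∈ idealOfVars (Fin d) B)
    (hF' : F' ∈ idealOfVars (Fin d) B) (h : ψ F = toJetRing B d n F') (i : ℕ) :
    minorsIdeal (jetMatrix n F) (Fintype.card (JetIndex d n) - i) =
      minorsIdeal (jetMatrix n F') (Fintype.card (JetIndex d n) - i) := by
  rw [← fittingIdeal_quotient_eq_minorsIdeal ψ hψ hker F hF _ h _ hV _ rfl i]
  exact fittingIdeal_quotient_eq_minorsIdeal
    (Ideal.Quotient.mkₐ B (idealOfVars (Fin d) B ^ (n + 1))) Ideal.Quotient.mk_surjective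
    (Ideal.Quotient.mkₐ_ker B _) F' hF' _ rfl _ rfl _ rfl i

/-- Modulo an ideal `a`, the ideal of minors of the multiplication by `F` only depends on the ideal
generated by `F` in the ring of jets modulo `a`. -/
theorem minorsIdeal_jetMatrix_le {B : Type*} [CommRing B] {n : ℕ} (a : Ideal B)
    {F F' : MvPolynomial (Fin d) B}
    (h : F ∈ Ideal.span {F'} ⊔ idealOfVars (Fin d) B ^ (n + 1) ⊔ a.map C) (k : ℕ) :
    minorsIdeal (jetMatrix n F) k ≤ minorsIdeal (jetMatrix n F') k ⊔ a := by
  obtain ⟨y, hy, w, hw, rfl⟩ := Submodule.mem_sup.mp h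
  obtain ⟨x, hx, z, hz, rfl⟩ := Submodule.mem_sup.mp hy
  obtain ⟨q, rfl⟩ := Ideal.mem_span_singleton'.mp hx
  have hw' : map (Ideal.Quotient.mk a) w = 0 := by
    ext m
    rw [coeff_map, coeff_zero, Ideal.Quotient.eq_zero_iff_mem]
    exact mem_map_C_iff.mp hw m
  have hle : (minorsIdeal (jetMatrix n (q * F' + z + w)) k).map (Ideal.Quotient.mk a) ≤
      (minorsIdeal (jetMatrix n F') k).map (Ideal.Quotient.mk a) := by
    rw [minorsIdeal_map, minorsIdeal_map, jetMatrix_map, jetMatrix_map, map_add, hw', add_zero]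
    refine minorsIdeal_le_of_rows_mem_span _ _ (fun α => ?_) k
    have e : jetMatrix n (map (Ideal.Quotient.mk a) (q * F' + z)) α = fun β : JetIndex d n =>
        coeff β.1 ((monomial α 1 * map (Ideal.Quotient.mk a) q) *
          map (Ideal.Quotient.mk a) F') := by
      funext β
      have hz' : coeff β.1 (monomial α 1 * map (Ideal.Quotient.mk a) z) = 0 := by
        have h1 : (monomial α 1 * z) ∈ idealOfVars (Fin d) B ^ (n + 1) := Ideal.mul_mem_left _ _ hz
        have h2 := (mem_pow_idealOfVars_iff' _ _).mp h1 β.1 (Nat.lt_succ_of_le β.2.2)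
        have h3 : monomial α 1 * map (Ideal.Quotient.mk a) z =
            map (Ideal.Quotient.mk a) (monomial α 1 * z) := by
          rw [map_mul, map_monomial, RingHom.map_one]
        rw [h3, coeff_map, h2, map_zero]
      simp only [jetMatrix, Matrix.of_apply, map_add, map_mul, mul_add, coeff_add, hz', add_zero,
        mul_assoc]
    rw [e]
    exact coeff_mul_mem_span_jetMatrix n _ _
  intro m hm
  exact Ideal.mem_quotient_iff_mem_sup.mp (hle (Ideal.mem_map_of_mem _ hm))

/-- The `i`-th Fitting ideal of the module of differentials of order `n` of a germ `a`, i.e. of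
`(δ) / ((δ) ^ (n + 1), a(x + δ) - a(x))`. -/
noncomputable def germFittingIdeal (n i : ℕ) (a : convergentSeries d) :
    Ideal (convergentSeries d) :=
  minorsIdeal (jetMatrix n (germIncrement n a)) (Fintype.card (JetIndex d n) - i)

/-- Automorphisms of the algebra of germs respect the Fitting ideals of germs. -/
theorem map_germFittingIdeal (n i : ℕ) (φ : convergentSeries d ≃ₐ[ℂ] convergentSeries d)
    (a : convergentSeries d) :
    (germFittingIdeal n i a).map φ.toRingEquiv.toRingHom = germFittingIdeal n i (φ a) := by
  let φ' : convergentSeries d →+* convergentSeries d := φ.toRingEquiv.toRingHom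
  let σ : convergentSeries d →+* convergentSeries d := φ.symm.toRingEquiv.toRingHom
  have hσφ : ∀ p : MvPolynomial (Fin d) (convergentSeries d), map σ (map φ' p) = p := fun p => by
    ext m : 1
    rw [coeff_map, coeff_map]
    exact φ.symm_apply_apply _
  have hmap : ∀ p ∈ idealOfVars (Fin d) (convergentSeries d),
      map φ' p ∈ idealOfVars (Fin d) (convergentSeries d) := fun p hp => by
    rw [mem_idealOfVars_iff] at hp ⊢
    rw [constantCoeff_map, hp, map_zero]
  -- The semilinear action of `φ` on jets is made linear by undoing `φ` on the coefficients.
  let ψ : MvPolynomial (Fin d) (convergentSeries d) →ₐ[convergentSeries d]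
      JetRing (convergentSeries d) d n :=
    { (jetMap n φ.toAlgHom).comp ((toJetRing _ d n).comp (map σ)) with
      commutes' := fun b => by
        change jetMap n φ.toAlgHom (toJetRing _ d n (map σ (C b))) = toJetRing _ d n (C b)
        rw [map_C, jetMap_C]
        exact congrArg (fun b => toJetRing _ d n (C b)) (φ.apply_symm_apply b) }
  have hψ : ∀ p, ψ p = jetMap n φ.toAlgHom (toJetRing _ d n (map σ p)) := fun _ => rfl
  have hinv : ∀ x, jetMap n φ.toAlgHom (jetMap n φ.symm.toAlgHom x) = x := fun x =>
    jetMap_comp n φ.symm.toAlgHom φ.toAlgHom (fun a => φ.apply_symm_apply a) x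
  have hinv' : ∀ x, jetMap n φ.symm.toAlgHom (jetMap n φ.toAlgHom x) = x := fun x =>
    jetMap_comp n φ.toAlgHom φ.symm.toAlgHom (fun a => φ.symm_apply_apply a) x
  rw [germFittingIdeal, germFittingIdeal, minorsIdeal_map, jetMatrix_map]
  refine minorsIdeal_jetMatrix_eq_of_algHom ψ ?_ ?_ ?_ (hmap _ (germIncrement_mem n a))
    (germIncrement_mem n _) ?_ i
  · intro x
    obtain ⟨p, hp⟩ := Ideal.Quotient.mk_surjective (jetMap n φ.symm.toAlgHom x)
    exact ⟨map φ' p, by rw [hψ, hσφ, hp, hinv]⟩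
  · ext p
    have h0 : ψ p = 0 ↔ toJetRing _ d n (map σ p) = 0 := by
      rw [hψ]
      refine ⟨fun h => ?_, fun h => by rw [h, map_zero]⟩
      rw [← hinv' (toJetRing _ d n (map σ p)), h, map_zero]
    rw [RingHom.mem_ker, h0, Ideal.Quotient.eq_zero_iff_mem, mem_pow_idealOfVars_iff',
      mem_pow_idealOfVars_iff']
    refine forall₂_congr fun x _ => ?_
    rw [coeff_map]
    exact map_eq_zero_iff φ.symm φ.symm.injective
  · apply le_antisymm
    · rw [Ideal.map_span, Ideal.span_le]
      rintro _ ⟨_, ⟨j, rfl⟩, rfl⟩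
      rw [SetLike.mem_coe, hψ, map_X]
      exact jetMap_mem n _ (Ideal.mem_map_of_mem _ (Ideal.subset_span ⟨j, rfl⟩))
    · intro x hx
      obtain ⟨p, hp, h⟩ := (Ideal.mem_map_iff_of_surjective _ Ideal.Quotient.mk_surjective).mp
        (jetMap_mem n φ.symm.toAlgHom hx)
      have e : x = ψ (map φ' p) := by rw [hψ, hσφ, h, hinv]
      rw [e]
      exact Ideal.mem_map_of_mem _ (hmap p hp)
  · rw [hψ, hσφ]
    exact jetMap_germIncrement n φ.toAlgHom a

theorem germFittingIdeal_mul_le (n i : ℕ) (u a : convergentSeries d) :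
    germFittingIdeal n i (u * a) ≤ germFittingIdeal n i a ⊔ Ideal.span {a} := by
  refine minorsIdeal_jetMatrix_le _ ?_ _
  -- `u(x + δ) a(x + δ) - u a = u(x + δ) (a(x + δ) - a) + (u(x + δ) - u) a`
  have h : germIncrement n (u * a) - (jetPoly n u * germIncrement n a + germIncrement n u * C a) ∈
      idealOfVars (Fin d) (convergentSeries d) ^ (n + 1) := by
    refine (toJetRing_eq_zero_iff _).mp ?_
    simp only [map_sub, map_add, map_mul, toJetRing_germIncrement, toJetRing_jetPoly]
    ring
  have h1 : jetPoly n u * germIncrement n a ∈ Ideal.span {germIncrement n a} :=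
    Ideal.mul_mem_left _ _ (Ideal.mem_span_singleton_self _)
  have h2 : germIncrement n u * C a ∈ (Ideal.span {a}).map C :=
    Ideal.mul_mem_left _ _ (Ideal.mem_map_of_mem _ (Ideal.mem_span_singleton_self _))
  have h3 := Ideal.add_mem _ (Ideal.mem_sup_left (Ideal.mem_sup_right h))
    (Ideal.add_mem _ (Ideal.mem_sup_left (Ideal.mem_sup_left h1)) (Ideal.mem_sup_right h2))
  rwa [sub_add_cancel] at h3

theorem span_sup_germFittingIdeal_mul_le (n i : ℕ) (u a : convergentSeries d) :
    Ideal.span {u * a} ⊔ germFittingIdeal n i (u * a) ≤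
      Ideal.span {a} ⊔ germFittingIdeal n i a := by
  refine sup_le (le_sup_of_le_left ?_) ((germFittingIdeal_mul_le n i u a).trans (sup_comm _ _).le)
  rw [Ideal.span_singleton_le_iff_mem]
  exact Ideal.mul_mem_left _ _ (Ideal.mem_span_singleton_self a)

theorem minorsIdeal_jetMatrix_eq_of_sub_mem {B : Type*} [CommRing B] {n : ℕ}
    {F F' : MvPolynomial (Fin d) B} (h : F - F' ∈ idealOfVars (Fin d) B ^ (n + 1)) (k : ℕ) :
    minorsIdeal (jetMatrix n F) k = minorsIdeal (jetMatrix n F') k := by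
  have hle : ∀ {F F' : MvPolynomial (Fin d) B}, F - F' ∈ idealOfVars (Fin d) B ^ (n + 1) →
      minorsIdeal (jetMatrix n F) k ≤ minorsIdeal (jetMatrix n F') k := fun {F F'} h => by
    have h1 := Ideal.add_mem _ (Ideal.mem_sup_right h)
      (Ideal.mem_sup_left (Ideal.mem_span_singleton_self F'))
    rw [sub_add_cancel] at h1
    have h2 := minorsIdeal_jetMatrix_le ⊥ (Ideal.mem_sup_left h1) k
    rwa [sup_bot_eq] at h2
  exact le_antisymm (hle h) (hle (by rwa [← neg_mem_iff, neg_sub]))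

theorem map_increment_sub_germIncrement_mem (n : ℕ) (f : MvPolynomial (Fin d) ℂ) :
    map (polyToSeries d).toRingHom (increment f) - germIncrement n (polyToSeries d f) ∈
      idealOfVars (Fin d) (convergentSeries d) ^ (n + 1) := by
  refine (toJetRing_eq_zero_iff _).mp ?_
  rw [map_sub, sub_eq_zero, toJetRing_germIncrement, jet_eq_of_taylor_eq n (taylor_polyToSeries f), increment,
    map_sub, map_sub, map_C]
  rfl

/-- Over the ring of germs, the higher Jacobian ideal of a polynomial is the corresponding Fitting
ideal of its germ. -/
theorem map_jacobianIdeal (n : ℕ) (f : MvPolynomial (Fin d) ℂ) :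
    (jacobianIdeal n f).map (polyToSeries d).toRingHom =
      germFittingIdeal n ((d - 1 + n).choose (d - 1) - 1) (polyToSeries d f) := by
  rw [jacobianIdeal_eq_minorsIdeal, minorsIdeal_map, jetMatrix_map, germFittingIdeal]
  exact minorsIdeal_jetMatrix_eq_of_sub_mem (map_increment_sub_germIncrement_mem n f) _

theorem nashIdeal_eq (n : ℕ) (f : MvPolynomial (Fin d) ℂ) :
    nashIdeal n f = Ideal.span {polyToSeries d f} ⊔
      germFittingIdeal n ((d - 1 + n).choose (d - 1) - 1) (polyToSeries d f) := by
  rw [← map_jacobianIdeal]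
  rfl

end Contact

end NashBlowup

theorem theorem2 (d : ℕ) (hd : 1 ≤ d) (f g : MvPolynomial (Fin d) ℂ)
    (hf : MvPolynomial.eval 0 f = 0) (hg : MvPolynomial.eval 0 g = 0)
    (hfg : NashBlowup.ContactEquivalent
      (NashBlowup.polyToSeries d f) (NashBlowup.polyToSeries d g))
    (n : ℕ) (hn : 1 ≤ n) :
    Nonempty (NashBlowup.NashAlgebra n f ≃ₐ[ℂ] NashBlowup.NashAlgebra n g) := by
  obtain ⟨φ, u, hu⟩ := hfg
  refine ⟨Ideal.quotientEquivAlg _ _ φ ?_⟩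
  have hφ : (NashBlowup.nashIdeal n f).map (φ : _ →+* _) =
      (NashBlowup.nashIdeal n f).map φ.toRingEquiv.toRingHom := rfl
  rw [hφ, NashBlowup.nashIdeal_eq, NashBlowup.nashIdeal_eq, Ideal.map_sup,
    NashBlowup.map_germFittingIdeal, Ideal.map_span, Set.image_singleton, hu]
  refine le_antisymm (NashBlowup.span_sup_germFittingIdeal_mul_le n _ _ _) ?_
  have h := NashBlowup.span_sup_germFittingIdeal_mul_le n
    ((d - 1 + n).choose (d - 1) - 1) (↑u⁻¹ : NashBlowup.convergentSeries d)
    (↑u * φ (NashBlowup.polyToSeries d f))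
  rwa [Units.inv_mul_cancel_left] at h
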